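/- Let $\mathcal{E}=(\mathcal{A},\mathcal{S})$ be a (Quillen) exact category with enough projectives such that $\mathcal{A}$ is weakly idempotent complete (every section has a cokernel). Subcategories are full and closed under isomorphisms. Write $\rightarrowtail$ and $\twoheadrightarrow$ for inflations and deflations; a morphism is admissible if it is a deflation followed by an inflation. For subcategories $\mathcal{T},\mathcal{D}$ put $\mathsf{Fac}\,\mathcal{T}=\{X : \exists\, T\twoheadrightarrow X,\ T\in\mathcal{T}\}$, ${}^{\bot_1}\mathcal{D}=\{X : \mathrm{Ext}^1_{\mathcal{E}}(X,\mathcal{D})=0\}$, $\mathcal{T}^{\bot_0}=\{Y : \mathrm{Hom}(\mathcal{T},Y)=0\}$ and $\mathcal{T}^{\bot}=\{Y : \mathrm{Ext}^i_{\mathcal{E}}(\mathcal{T},Y)=0\ \forall i\ge 1\}$. * A subcategory $\mathcal{T}$ closed under direct summands of finite direct sums is *support $\tau$-tilting* if $\mathrm{Ext}^1_{\mathcal{E}}(\mathcal{T},\mathsf{Fac}\,\mathcal{T})=0$ and every projective $P$ admits an exact sequence $P\xrightarrow{f}T^0\twoheadrightarrow T^1$ with $T^0,T^1\in\mathcal{T}$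 and $f$ a left $\mathcal{T}$-approximation. * $\mathcal{T}$ is *tilting* if $\mathcal{T}^{\bot}$, with the conflations of $\mathcal{E}$ lying in it, has enough projectives and its subcategory of projectives is $\mathcal{T}$, and every $X\in\mathcal{E}$ admits a conflation $X\rightarrowtail Y_0\twoheadrightarrow Y_1$ with $Y_0,Y_1\in\mathcal{T}^{\bot}$. * $\mathcal{T}$ is *admissibly contravariantly finite* (a.c.f.) if every $X\in\mathcal{E}$ has an admissible right $\mathcal{T}$-approximation. * $(\mathcal{C},\mathcal{D})$ is a *$\tau$-cotorsion pair* if $\mathcal{C}={}^{\bot_1}\mathcal{D}$ and every projective $P$ admits an exact sequence $P\xrightarrow{f}D\twoheadrightarrow C$ with $D\in\mathcal{C}\cap\mathcal{D}$, $C\in\mathcal{C}$ and $f$ a left $\mathcal{D}$-approximation. * $(\mathcal{C},\mathcal{D})$ is a *cotorsion pair* if $\mathcal{C},\mathcal{D}$ are closed under direct summands, $\mathrm{Ext}^1_{\mathcal{E}}(\mathcal{C},\mathcal{D})=0$, and every $X\in\mathcal{E}$ admits conflations $D\rightarrowtail C\twoheadrightarrow X$ and $X\rightarrowtail D'\twoheadrightarrow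 C'$ with $C,C'\in\mathcal{C}$ and $D,D'\in\mathcal{D}$. * $(\mathcal{D},\mathcal{F})$ is a *torsion pair* if $\mathrm{Hom}(\mathcal{D},\mathcal{F})=0$ and every $X\in\mathcal{E}$ admits a conflation $D\rightarrowtail X\twoheadrightarrow F$ with $D\in\mathcal{D}$, $F\in\mathcal{F}$. A *torsion class* is a subcategory $\mathcal{D}$ closed under extensions with $\mathsf{Fac}\,\mathcal{D}\subseteq\mathcal{D}$. * $(\mathcal{C},\mathcal{D},\mathcal{F})$ is a *($\tau$-)cotorsion torsion triple* if $(\mathcal{C},\mathcal{D})$ is a ($\tau$-)cotorsion pair and $(\mathcal{D},\mathcal{F})$ is a torsion pair. The assignments $\mathcal{T}\mapsto({}^{\bot_1}\mathsf{Fac}\,\mathcal{T},\mathsf{Fac}\,\mathcal{T})$ and $(\mathcal{C},\mathcal{D})\mapsto\mathcal{C}\cap\mathcal{D}$ are mutually inverse bijections between support $\tau$-tilting subcategories and $\tau$-cotorsion pairs $(\mathcal{C},\mathcal{D})$ with $\mathcal{D}$ a torsion class, and likewise between tilting subcategories and cotorsion pairs $(\mathcal{C},\mathcal{D})$ with $\mathcal{D}$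 a torsion class. These bijections restrict to further ones: the assignments $$\mathcal{T}\mapsto({}^{\bot_1}\mathsf{Fac}\,\mathcal{T},\ \mathsf{Fac}\,\mathcal{T},\ \mathcal{T}^{\bot_0}),\qquad (\mathcal{C},\mathcal{D},\mathcal{F})\mapsto\mathcal{C}\cap\mathcal{D}$$ are mutually inverse bijections $$\{\text{a.c.f. support }\tau\text{-tilting subcategories}\}\leftrightarrow\{\tau\text{-cotorsion torsion triples}\}$$ and $$\{\text{a.c.f. tilting subcategories}\}\leftrightarrow\{\text{cotorsion torsion triples}\}.$$ Here tilting subcategories are support $\tau$-tilting, every cotorsion torsion triple is a $\tau$-cotorsion torsion triple, and for every $\tau$-cotorsion torsion triple $(\mathcal{C},\mathcal{D},\mathcal{F})$ the pair $(\mathcal{C},\mathcal{D})$ is a $\tau$-cotorsion pair with $\mathcal{D}$ a torsion class. -/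

import Mathlib

open CategoryTheory CategoryTheory.Limits

universe v u

section Exact

variable {A : Type u} [Category.{v} A] [Preadditive A]

/-- The morphisms which are the first map of a pair belonging to the class `S`. -/
def inflationsOf (S : ObjectProperty (ShortComplex A)) : MorphismProperty A :=
  fun _ Y f => ∃ (Z : A) (g : Y ⟶ Z) (w : f ≫ g = 0), S (ShortComplex.mk f g w)

/-- The morphisms which are the second map of a pair belonging to the class `S`. -/
def deflationsOf (S : ObjectProperty (ShortComplex A)) : MorphismProperty A :=
  fun Y _ g => ∃ (X : A) (f : X ⟶ Y) (w : f ≫ g = 0), S (ShortComplex.mk f g w)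

variable (A) in
/-- A (Quillen) exact structure on an additive category: a class of kernel-cokernel pairs, closed
under isomorphisms, such that identities are inflations and deflations, inflations and deflations
are closed under composition, pushouts of inflations along arbitrary morphisms exist and are
inflations, and pullbacks of deflations along arbitrary morphisms exist and are deflations. -/
structure ExactStructure where
  /-- The class of conflations. -/
  conflation : ObjectProperty (ShortComplex A)
  isoClosed : conflation.IsClosedUnderIsomorphisms
  isKernel : ∀ S : ShortComplex A, conflation S → Nonempty (IsLimit (KernelFork.ofι S.f S.zero))
  isCokernel : ∀ S : ShortComplex A, conflation S →
    Nonempty (IsColimit (CokernelCofork.ofπ S.g S.zero))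
  id_inflation : ∀ X : A, inflationsOf conflation (𝟙 X)
  id_deflation : ∀ X : A, deflationsOf conflation (𝟙 X)
  comp_inflation : ∀ {X Y Z : A} (f : X ⟶ Y) (g : Y ⟶ Z), inflationsOf conflation f →
    inflationsOf conflation g → inflationsOf conflation (f ≫ g)
  comp_deflation : ∀ {X Y Z : A} (f : X ⟶ Y) (g : Y ⟶ Z), deflationsOf conflation f →
    deflationsOf conflation g → deflationsOf conflation (f ≫ g)
  pushout_inflation : ∀ {X Y X' : A} (f : X ⟶ Y) (a : X ⟶ X'), inflationsOf conflation f →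
    ∃ (Y' : A) (b : Y ⟶ Y') (f' : X' ⟶ Y'), IsPushout f a b f' ∧ inflationsOf conflation f'
  pullback_deflation : ∀ {Y Z Z' : A} (g : Y ⟶ Z) (c : Z' ⟶ Z), deflationsOf conflation g →
    ∃ (Y' : A) (b : Y' ⟶ Y) (g' : Y' ⟶ Z'), IsPullback b g' g c ∧ deflationsOf conflation g'

variable (A) in
/-- Every section (split monomorphism) has a cokernel. -/
def WeaklyIdempotentComplete : Prop :=
  ∀ {X Y : A} (s : X ⟶ Y) (r : Y ⟶ X), s ≫ r = 𝟙 X → HasCokernel s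

namespace ExactStructure

variable (E : ExactStructure A)

/-- The inflations of the exact category. -/
def Inflation {X Y : A} (f : X ⟶ Y) : Prop := inflationsOf E.conflation f

/-- The deflations of the exact category. -/
def Deflation {X Y : A} (f : X ⟶ Y) : Prop := deflationsOf E.conflation f

/-- `f` and `g` are the two maps of a conflation `X ↣ Y ↠ Z`. -/
def IsConflation {X Y Z : A} (f : X ⟶ Y) (g : Y ⟶ Z) : Prop :=
  ∃ w : f ≫ g = 0, E.conflation (ShortComplex.mk f g w)

/-- Admissible morphisms: a deflation followed by an inflation. -/
def Admissible {X Y : A} (f : X ⟶ Y) : Prop :=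
  ∃ (I : A) (d : X ⟶ I) (i : I ⟶ Y), E.Deflation d ∧ E.Inflation i ∧ d ≫ i = f

/-- The sequence `X ⟶ Y ↠ Z` is exact: `f` is admissible, `g` is a deflation, and the image
`i` of `f` is the kernel of `g`. -/
def IsRightExact {X Y Z : A} (f : X ⟶ Y) (g : Y ⟶ Z) : Prop :=
  ∃ (I : A) (d : X ⟶ I) (i : I ⟶ Y), E.Deflation d ∧ E.IsConflation i g ∧ d ≫ i = f

/-- Projective objects of the exact category. -/
def IsProjective (P : A) : Prop :=
  ∀ {Y Z : A} (g : Y ⟶ Z), E.Deflation g → ∀ h : P ⟶ Z, ∃ l : P ⟶ Y, l ≫ g = h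

/-- Every object is the target of a deflation from a projective object. -/
class EnoughProjectives : Prop where
  exists_deflation : ∀ X : A, ∃ (P : A) (p : P ⟶ X), E.IsProjective P ∧ E.Deflation p

/-- A projective resolution of `X`, cut into conflations `syz (n + 1) ↣ obj n ↠ syz n`
with `syz 0 ≅ X`. -/
structure ProjRes (X : A) where
  /-- The terms of the resolution. -/
  obj : ℕ → A
  /-- The syzygies. -/
  syz : ℕ → A
  /-- The inclusion of a syzygy. -/
  ι : ∀ n, syz (n + 1) ⟶ obj n
  /-- The projection to a syzygy. -/
  π : ∀ n, obj n ⟶ syz n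
  isConflation : ∀ n, E.IsConflation (ι n) (π n)
  isProjective : ∀ n, E.IsProjective (obj n)
  /-- The object resolved. -/
  isoZero : syz 0 ≅ X

theorem nonempty_projRes [h : E.EnoughProjectives] (X : A) : Nonempty (E.ProjRes X) := by
  have H : ∀ Y : A, ∃ (K P : A) (i : K ⟶ P) (p : P ⟶ Y), E.IsConflation i p ∧
      E.IsProjective P := by
    intro Y
    obtain ⟨P, p, hP, K, i, w, hc⟩ := h.exists_deflation Y
    exact ⟨K, P, i, p, ⟨w, hc⟩, hP⟩
  choose K P i p hc hP using H
  let s : ℕ → A := fun n => Nat.rec X (fun _ Y => K Y) n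
  exact ⟨{ obj := fun n => P (s n), syz := s, ι := fun n => i (s n), π := fun n => p (s n),
           isConflation := fun n => hc (s n), isProjective := fun n => hP (s n),
           isoZero := Iso.refl X }⟩

namespace ProjRes

variable {E} {X : A} (R : E.ProjRes X) (Y : A)

/-- The differential of a projective resolution. -/
def d (n : ℕ) : R.obj (n + 1) ⟶ R.obj n := R.π (n + 1) ≫ R.ι n

/-- The `n`-cocycles of the complex `Hom(P_•, Y)`. -/
def cocycles (n : ℕ) : AddSubgroup (R.obj n ⟶ Y) := (Preadditive.leftComp Y (R.d n)).ker

/-- The `n`-coboundaries of the complex `Hom(P_•, Y)`. -/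
def coboundaries : (n : ℕ) → AddSubgroup (R.obj n ⟶ Y)
  | 0 => ⊥
  | n + 1 => (Preadditive.leftComp Y (R.d n)).range

/-- The `n`-th cohomology group of the complex `Hom(P_•, Y)`. -/
abbrev cohomology (n : ℕ) : Type v :=
  R.cocycles Y n ⧸ (R.coboundaries Y n).addSubgroupOf (R.cocycles Y n)

end ProjRes

section EnoughProjectives

variable [E.EnoughProjectives]

/-- A chosen projective resolution of `X`. -/
noncomputable def projRes (X : A) : E.ProjRes X := Classical.choice (E.nonempty_projRes X)

/-- The group `Ext^n(X, Y)` of the exact category, computed by a projective resolution. -/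
abbrev Ext (n : ℕ) (X Y : A) : Type v := (E.projRes X).cohomology Y n

/-- The subcategory of all `Y` with `Ext^n(X, Y) = 0` for all `X` in `𝒳`. -/
def rightPerp (n : ℕ) (𝒳 : ObjectProperty A) : ObjectProperty A :=
  fun Y => ∀ X, 𝒳 X → Subsingleton (E.Ext n X Y)

/-- The subcategory of all `X` with `Ext^n(X, Y) = 0` for all `Y` in `𝒴`. -/
def leftPerp (n : ℕ) (𝒴 : ObjectProperty A) : ObjectProperty A :=
  fun X => ∀ Y, 𝒴 Y → Subsingleton (E.Ext n X Y)

/-- The subcategory of all `Y` with `Ext^n(X, Y) = 0` for all `X` in `𝒳` and all `n ≥ 1`. -/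
def totalRightPerp (𝒳 : ObjectProperty A) : ObjectProperty A :=
  fun Y => ∀ n : ℕ, 1 ≤ n → E.rightPerp n 𝒳 Y

end EnoughProjectives

/-- The objects `X` admitting a deflation `T ↠ X` with `T` in `𝒯`. -/
def Fac (𝒯 : ObjectProperty A) : ObjectProperty A :=
  fun X => ∃ (T : A) (p : T ⟶ X), 𝒯 T ∧ E.Deflation p

end ExactStructure

/-- The subcategory of all `Y` with `Hom(X, Y) = 0` for all `X` in `𝒳`. -/
def homRightPerp (𝒳 : ObjectProperty A) : ObjectProperty A :=
  fun Y => ∀ X, 𝒳 X → ∀ f : X ⟶ Y, f = 0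

/-- `f : X ⟶ T` is a left `𝒯`-approximation. -/
def IsLeftApprox (𝒯 : ObjectProperty A) {X T : A} (f : X ⟶ T) : Prop :=
  𝒯 T ∧ ∀ T', 𝒯 T' → ∀ h : X ⟶ T', ∃ l : T ⟶ T', f ≫ l = h

/-- `f : T ⟶ X` is a right `𝒯`-approximation. -/
def IsRightApprox (𝒯 : ObjectProperty A) {T X : A} (f : T ⟶ X) : Prop :=
  𝒯 T ∧ ∀ T', 𝒯 T' → ∀ h : T' ⟶ X, ∃ l : T' ⟶ T, l ≫ f = h

/-- Closed under direct summands (in particular under isomorphisms). -/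
def SummandClosed [HasBinaryBiproducts A] (𝒞 : ObjectProperty A) : Prop :=
  ∀ {X X' Y : A}, (Y ≅ X ⊞ X') → 𝒞 Y → 𝒞 X

/-- Closed under direct summands of finite direct sums (including the empty sum). -/
structure AdditivelyClosed [HasBinaryBiproducts A] (𝒞 : ObjectProperty A) : Prop where
  zero : ∀ {Z : A}, IsZero Z → 𝒞 Z
  biprod : ∀ {X Y : A}, 𝒞 X → 𝒞 Y → 𝒞 (X ⊞ Y)
  summand : SummandClosed 𝒞

namespace ExactStructure

variable (E : ExactStructure A)

/-- The projective objects of a full subcategory `𝒞`, with respect to the conflations of the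
ambient exact category all of whose terms lie in `𝒞`. -/
def projectivesOf (𝒞 : ObjectProperty A) : ObjectProperty A :=
  fun P => 𝒞 P ∧ ∀ {X Y Z : A} (f : X ⟶ Y) (g : Y ⟶ Z), E.IsConflation f g →
    𝒞 X → 𝒞 Y → 𝒞 Z → ∀ h : P ⟶ Z, ∃ l : P ⟶ Y, l ≫ g = h

/-- The full subcategory `𝒞`, with the conflations lying in it, has enough projectives and its
subcategory of projective objects is `𝒯`. -/
def HasEnoughProjectivesGivenBy (𝒞 𝒯 : ObjectProperty A) : Prop :=
  E.projectivesOf 𝒞 = 𝒯 ∧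
  ∀ X, 𝒞 X → ∃ (Y T : A) (i : Y ⟶ T) (p : T ⟶ X), E.IsConflation i p ∧ 𝒞 Y ∧ 𝒞 T ∧ 𝒯 T

/-- Torsion classes: closed under factors and under extensions. -/
structure IsTorsionClass (𝒟 : ObjectProperty A) : Prop where
  isoClosed : 𝒟.IsClosedUnderIsomorphisms
  factorClosed : ∀ X, E.Fac 𝒟 X → 𝒟 X
  extensionClosed : ∀ {X Y Z : A} (f : X ⟶ Y) (g : Y ⟶ Z), E.IsConflation f g →
    𝒟 X → 𝒟 Z → 𝒟 Y

/-- Torsion pairs. -/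
structure IsTorsionPair (𝒞 𝒟 : ObjectProperty A) : Prop where
  isoClosed_left : 𝒞.IsClosedUnderIsomorphisms
  isoClosed_right : 𝒟.IsClosedUnderIsomorphisms
  hom_eq_zero : ∀ {C D : A}, 𝒞 C → 𝒟 D → ∀ f : C ⟶ D, f = 0
  exists_conflation : ∀ X : A, ∃ (C D : A) (i : C ⟶ X) (p : X ⟶ D),
    E.IsConflation i p ∧ 𝒞 C ∧ 𝒟 D

/-- `𝒯` is admissibly contravariantly finite: every object has an admissible right
`𝒯`-approximation. -/
def IsACF (𝒯 : ObjectProperty A) : Prop :=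
  ∀ X : A, ∃ (T : A) (f : T ⟶ X), IsRightApprox 𝒯 f ∧ E.Admissible f

variable [E.EnoughProjectives]

/-- (1-)tilting subcategories: `𝒯^⊥` has enough projectives `𝒯`, and every object `X` has a
coresolution `X ↣ Y₀ ↠ Y₁` with `Y₀`, `Y₁` in `𝒯^⊥`. -/
structure IsTilting (𝒯 : ObjectProperty A) : Prop where
  enoughProjectives : E.HasEnoughProjectivesGivenBy (E.totalRightPerp 𝒯) 𝒯
  coresolution : ∀ X : A, ∃ (Y₀ Y₁ : A) (i : X ⟶ Y₀) (p : Y₀ ⟶ Y₁),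
    E.IsConflation i p ∧ E.totalRightPerp 𝒯 Y₀ ∧ E.totalRightPerp 𝒯 Y₁

/-- `τ`-cotorsion pairs. -/
structure IsTauCotorsionPair (𝒞 𝒟 : ObjectProperty A) : Prop where
  isoClosed_left : 𝒞.IsClosedUnderIsomorphisms
  isoClosed_right : 𝒟.IsClosedUnderIsomorphisms
  eq_leftPerp : 𝒞 = E.leftPerp 1 𝒟
  exists_approx : ∀ P : A, E.IsProjective P → ∃ (D C : A) (f : P ⟶ D) (g : D ⟶ C),
    E.IsRightExact f g ∧ 𝒞 D ∧ 𝒟 D ∧ 𝒞 C ∧ IsLeftApprox 𝒟 f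

variable [HasBinaryBiproducts A]

/-- Support `τ`-tilting subcategories. -/
structure IsSupportTauTilting (𝒯 : ObjectProperty A) : Prop where
  additivelyClosed : AdditivelyClosed 𝒯
  rigid : ∀ {T X : A}, 𝒯 T → E.Fac 𝒯 X → Subsingleton (E.Ext 1 T X)
  exists_approx : ∀ P : A, E.IsProjective P → ∃ (T₀ T₁ : A) (f : P ⟶ T₀) (g : T₀ ⟶ T₁),
    E.IsRightExact f g ∧ 𝒯 T₀ ∧ 𝒯 T₁ ∧ IsLeftApprox 𝒯 f

/-- (Complete) cotorsion pairs. -/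
structure IsCotorsionPair (𝒞 𝒟 : ObjectProperty A) : Prop where
  summandClosed_left : SummandClosed 𝒞
  summandClosed_right : SummandClosed 𝒟
  ext_eq_zero : ∀ {C D : A}, 𝒞 C → 𝒟 D → Subsingleton (E.Ext 1 C D)
  exists_left : ∀ X : A, ∃ (D C : A) (i : D ⟶ C) (p : C ⟶ X),
    E.IsConflation i p ∧ 𝒞 C ∧ 𝒟 D
  exists_right : ∀ X : A, ∃ (D C : A) (i : X ⟶ D) (p : D ⟶ C),
    E.IsConflation i p ∧ 𝒞 C ∧ 𝒟 D

/-- `τ`-cotorsion torsion triples. -/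
def IsTauCotorsionTorsionTriple (𝒞 𝒟 ℱ : ObjectProperty A) : Prop :=
  E.IsTauCotorsionPair 𝒞 𝒟 ∧ E.IsTorsionPair 𝒟 ℱ

/-- Cotorsion torsion triples. -/
def IsCotorsionTorsionTriple (𝒞 𝒟 ℱ : ObjectProperty A) : Prop :=
  E.IsCotorsionPair 𝒞 𝒟 ∧ E.IsTorsionPair 𝒟 ℱ

end ExactStructure

end Exact

/-- `f` and `g` restrict to mutually inverse bijections between the sets `s` and `t`. -/
def MutuallyInverseOn {α β : Type*} (f : α → β) (g : β → α) (s : Set α) (t : Set β) : Prop :=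
  Set.BijOn f s t ∧ Set.BijOn g t s ∧ Set.InvOn g f s t

/-! The class $\mathcal D=\mathsf{Fac}\,\mathcal T$ determines the rest: $\mathcal T$ is recovered
as ${}^{\bot_1}\mathcal D\cap\mathcal D$, and $\mathcal D$ from $\mathcal T$ by taking factors.

For support $\tau$-tilting $\mathcal T$, the crux is `IsSupportTauTilting.exists_isConflation`: each
$X\in\mathsf{Fac}\,\mathcal T$ is covered by an object of $\mathcal T$ with kernel again in
$\mathsf{Fac}\,\mathcal T$. If also $X\in{}^{\bot_1}\mathsf{Fac}\,\mathcal T$, the cover splits and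
$X\in\mathcal T$. Conversely (`IsTauCotorsionPair.fac_inf`), a projective cover of $X\in\mathcal D$
factors through a left $\mathcal D$-approximation $P\to D$, and weak idempotent completeness makes
$D\to X$ a deflation, so $\mathcal D=\mathsf{Fac}(\mathcal C\cap\mathcal D)$.

In the tilting case the two-term coresolutions kill $\mathrm{Ext}^{\ge 2}(\mathcal T,-)$, whence
$\mathcal T^{\bot}=\mathsf{Fac}\,\mathcal T$, and Salce's pushout argument gives a cotorsion pair.
Conversely, if $\mathcal D$ is closed under factors then $\mathrm{Ext}^2(\mathcal C,-)=0$, which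
yields $(\mathcal C\cap\mathcal D)^{\bot}=\mathcal D$.

Finally, being a.c.f. amounts to $\mathsf{Fac}\,\mathcal T$ being the left half of a torsion pair:
the image of an admissible approximation is the torsion part of an object, and covering the torsion
part by $\mathcal T$ with kernel in $\mathsf{Fac}\,\mathcal T$ gives an approximation
(`isTorsionPair`, `isACF`).

All Ext conditions are translated into extension of morphisms along inflations (`ExtOneVanishes`),
with higher Ext handled through syzygies. -/

namespace ExactStructure

/-! ### Elementary calculus of conflations. -/

section Basic

variable {A : Type u} [Category.{v} A] [Preadditive A] {E : ExactStructure A}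

namespace IsConflation

variable {X Y Z : A} {f : X ⟶ Y} {g : Y ⟶ Z}

theorem deflation (h : E.IsConflation f g) : E.Deflation g := ⟨X, f, h.1, h.2⟩

theorem inflation (h : E.IsConflation f g) : E.Inflation f := ⟨Z, g, h.1, h.2⟩

theorem exists_lift (h : E.IsConflation f g) {W : A} (t : W ⟶ Y) (ht : t ≫ g = 0) :
    ∃ l : W ⟶ X, l ≫ f = t := by
  obtain ⟨w, hc⟩ := h
  obtain ⟨hk⟩ := E.isKernel _ hc
  exact ⟨(KernelFork.IsLimit.lift' hk t ht).1, (KernelFork.IsLimit.lift' hk t ht).2⟩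

theorem exists_desc (h : E.IsConflation f g) {W : A} (t : Y ⟶ W) (ht : f ≫ t = 0) :
    ∃ l : Z ⟶ W, g ≫ l = t := by
  obtain ⟨w, hc⟩ := h
  obtain ⟨hk⟩ := E.isCokernel _ hc
  exact ⟨(CokernelCofork.IsColimit.desc' hk t ht).1, (CokernelCofork.IsColimit.desc' hk t ht).2⟩

theorem mono (h : E.IsConflation f g) : Mono f := by
  obtain ⟨w, hc⟩ := h
  obtain ⟨hk⟩ := E.isKernel _ hc
  exact ⟨fun a b hab => Fork.IsLimit.hom_ext hk hab⟩

theorem epi (h : E.IsConflation f g) : Epi g := by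
  obtain ⟨w, hc⟩ := h
  obtain ⟨hk⟩ := E.isCokernel _ hc
  exact ⟨fun a b hab => Cofork.IsColimit.hom_ext hk hab⟩

theorem of_iso (h : E.IsConflation f g) {X' Y' Z' : A} {f' : X' ⟶ Y'} {g' : Y' ⟶ Z'}
    (e₁ : X ≅ X') (e₂ : Y ≅ Y') (e₃ : Z ≅ Z') (h₁ : f ≫ e₂.hom = e₁.hom ≫ f')
    (h₂ : g ≫ e₃.hom = e₂.hom ≫ g') : E.IsConflation f' g' := by
  obtain ⟨w, hc⟩ := h
  have w' : f' ≫ g' = 0 := by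
    rw [← cancel_epi e₁.hom, ← Category.assoc, ← h₁, Category.assoc, ← h₂, reassoc_of% w]
    simp
  have := E.isoClosed
  exact ⟨w', ObjectProperty.prop_of_iso E.conflation
    (ShortComplex.isoMk (S₁ := ShortComplex.mk f g w) (S₂ := ShortComplex.mk f' g' w')
      e₁ e₂ e₃ h₁.symm h₂.symm) hc⟩

end IsConflation

theorem Deflation.exists_isConflation {Y Z : A} {g : Y ⟶ Z} (h : E.Deflation g) :
    ∃ (X : A) (f : X ⟶ Y), E.IsConflation f g := by
  obtain ⟨X, f, w, hc⟩ := h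
  exact ⟨X, f, w, hc⟩

theorem Inflation.exists_isConflation {X Y : A} {f : X ⟶ Y} (h : E.Inflation f) :
    ∃ (Z : A) (g : Y ⟶ Z), E.IsConflation f g := by
  obtain ⟨X, f, w, hc⟩ := h
  exact ⟨X, f, w, hc⟩

theorem Deflation.comp {X Y Z : A} {f : X ⟶ Y} {g : Y ⟶ Z} (hf : E.Deflation f)
    (hg : E.Deflation g) : E.Deflation (f ≫ g) := E.comp_deflation f g hf hg

theorem Inflation.comp {X Y Z : A} {f : X ⟶ Y} {g : Y ⟶ Z} (hf : E.Inflation f)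
    (hg : E.Inflation g) : E.Inflation (f ≫ g) := E.comp_inflation f g hf hg

theorem Deflation.epi {Y Z : A} {g : Y ⟶ Z} (h : E.Deflation g) : Epi g := by
  obtain ⟨X, f, hc⟩ := h.exists_isConflation
  exact hc.epi

/-- Kernels are unique up to isomorphism and conflations are closed under isomorphism, so any kernel
of a deflation completes it to a conflation. -/
theorem Deflation.isConflation {X Y Z : A} {k : X ⟶ Y} {g : Y ⟶ Z} (hg : E.Deflation g)
    [Mono k] (w : k ≫ g = 0) (hl : ∀ {W : A} (t : W ⟶ Y), t ≫ g = 0 → ∃ l, l ≫ k = t) :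
    E.IsConflation k g := by
  obtain ⟨X', f, hc⟩ := hg.exists_isConflation
  obtain ⟨a, ha⟩ := hc.exists_lift k w
  obtain ⟨b, hb⟩ := hl f hc.1
  have := hc.mono
  refine hc.of_iso ⟨b, a, ?_, ?_⟩ (Iso.refl _) (Iso.refl _) (by simp [hb]) (by simp)
  · rw [← cancel_mono f]; simp [ha, hb]
  · rw [← cancel_mono k]; simp [ha, hb]

theorem Inflation.isConflation {X Y Z : A} {f : X ⟶ Y} {q : Y ⟶ Z} (hf : E.Inflation f)
    [Epi q] (w : f ≫ q = 0) (hl : ∀ {W : A} (t : Y ⟶ W), f ≫ t = 0 → ∃ l, q ≫ l = t) :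
    E.IsConflation f q := by
  obtain ⟨Z', g, hc⟩ := hf.exists_isConflation
  obtain ⟨a, ha⟩ := hc.exists_desc q w
  obtain ⟨b, hb⟩ := hl g hc.1
  have := hc.epi
  refine hc.of_iso (Iso.refl _) (Iso.refl _) ⟨a, b, ?_, ?_⟩ (by simp) (by simp [ha])
  · rw [← cancel_epi g]; simp [reassoc_of% ha, hb]
  · rw [← cancel_epi q]; simp [reassoc_of% hb, ha]

variable (E) in
theorem deflation_of_iso {X Y : A} (e : X ≅ Y) : E.Deflation e.hom := by
  obtain ⟨K, k, hc⟩ := Deflation.exists_isConflation (E := E) (E.id_deflation X)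
  exact (hc.of_iso (g' := e.hom) (Iso.refl _) (Iso.refl _) e (f' := k) (by simp)
    (by simp)).deflation

variable (E) in
theorem inflation_of_iso {X Y : A} (e : X ≅ Y) : E.Inflation e.hom := by
  obtain ⟨K, k, hc⟩ := Inflation.exists_isConflation (E := E) (E.id_inflation X)
  exact (hc.of_iso (f' := e.hom) (Iso.refl _) e (Iso.refl _) (g' := e.inv ≫ k) (by simp)
    (by simp)).inflation

/-- Pullbacks of conflations. -/
theorem IsConflation.of_isPullback {X Y Z Y' Z' : A} {f : X ⟶ Y} {g : Y ⟶ Z} {b : Y' ⟶ Y}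
    {g' : Y' ⟶ Z'} {c : Z' ⟶ Z} (h : E.IsConflation f g) (sq : IsPullback b g' g c) :
    ∃ f' : X ⟶ Y', E.IsConflation f' g' ∧ f' ≫ b = f := by
  obtain ⟨Y₂, b₂, g₂, sq₂, hd⟩ := E.pullback_deflation g c h.deflation
  have hg' : E.Deflation g' := by
    have : (sq.isoIsPullback _ _ sq₂).hom ≫ g₂ = g' := by simp
    rw [← this]
    exact (E.deflation_of_iso _).comp hd
  have hb : sq.lift f 0 (by simp [h.1]) ≫ b = f := by simp
  have := h.mono
  have : Mono (sq.lift f 0 (by simp [h.1])) := by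
    have : Mono (sq.lift f 0 (by simp [h.1]) ≫ b) := by rwa [hb]
    exact mono_of_mono _ b
  refine ⟨_, hg'.isConflation (by simp) ?_, hb⟩
  intro W t ht
  obtain ⟨l, hl⟩ := h.exists_lift (t ≫ b) (by simp [sq.w, reassoc_of% ht])
  exact ⟨l, sq.hom_ext (by simp [hl]) (by simp [ht])⟩

/-- Pushouts of conflations. -/
theorem IsConflation.of_isPushout {X Y Z X' Y' : A} {f : X ⟶ Y} {g : Y ⟶ Z} {a : X ⟶ X'}
    {b : Y ⟶ Y'} {f' : X' ⟶ Y'} (h : E.IsConflation f g) (sq : IsPushout f a b f') :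
    ∃ g' : Y' ⟶ Z, E.IsConflation f' g' ∧ b ≫ g' = g := by
  obtain ⟨Y₂, b₂, f₂, sq₂, hd⟩ := E.pushout_inflation f a h.inflation
  have hf' : E.Inflation f' := by
    have : f₂ ≫ (sq₂.isoIsPushout _ _ sq).hom = f' := by simp
    rw [← this]
    exact Inflation.comp hd (E.inflation_of_iso _)
  have hb : b ≫ sq.desc g 0 (by simp [h.1]) = g := by simp
  have := h.epi
  have : Epi (sq.desc g 0 (by simp [h.1])) := by
    have : Epi (b ≫ sq.desc g 0 (by simp [h.1])) := by rwa [hb]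
    exact epi_of_epi b _
  refine ⟨_, hf'.isConflation (by simp) ?_, hb⟩
  intro W t ht
  obtain ⟨l, hl⟩ := h.exists_desc (b ≫ t) (by simp [reassoc_of% sq.w, ht])
  exact ⟨l, sq.hom_ext (by simp [hl]) (by simp [ht])⟩

theorem IsConflation.exists_pullback {X Y Z Z' : A} {f : X ⟶ Y} {g : Y ⟶ Z}
    (h : E.IsConflation f g) (c : Z' ⟶ Z) :
    ∃ (Y' : A) (b : Y' ⟶ Y) (f' : X ⟶ Y') (g' : Y' ⟶ Z'), IsPullback b g' g c ∧
      E.IsConflation f' g' ∧ f' ≫ b = f := by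
  obtain ⟨Y', b, g', sq, -⟩ := E.pullback_deflation g c h.deflation
  obtain ⟨f', hf', hb⟩ := h.of_isPullback sq
  exact ⟨Y', b, f', g', sq, hf', hb⟩

theorem IsConflation.exists_pushout {X Y Z X' : A} {f : X ⟶ Y} {g : Y ⟶ Z}
    (h : E.IsConflation f g) (a : X ⟶ X') :
    ∃ (Y' : A) (b : Y ⟶ Y') (f' : X' ⟶ Y') (g' : Y' ⟶ Z), IsPushout f a b f' ∧
      E.IsConflation f' g' ∧ b ≫ g' = g := by
  obtain ⟨Y', b, f', sq, -⟩ := E.pushout_inflation f a h.inflation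
  obtain ⟨g', hg', hb⟩ := h.of_isPushout sq
  exact ⟨Y', b, f', g', sq, hg', hb⟩

/-- A conflation whose deflation has a section is split. -/
theorem IsConflation.nonempty_iso_of_section [HasBinaryBiproducts A] {X Y Z : A} {f : X ⟶ Y}
    {g : Y ⟶ Z} (h : E.IsConflation f g) (s : Z ⟶ Y) (hs : s ≫ g = 𝟙 Z) :
    Nonempty (Y ≅ Z ⊞ X) := by
  obtain ⟨r, hr⟩ := h.exists_lift (𝟙 Y - g ≫ s) (by simp [hs])
  have := h.mono
  have hfr : f ≫ r = 𝟙 X := by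
    rw [← cancel_mono f]; simp [hr, reassoc_of% h.1]
  have hsr : s ≫ r = 0 := by
    rw [← cancel_mono f]; simp [hr, reassoc_of% hs]
  refine ⟨⟨biprod.lift g r, biprod.desc s f, by simp [hr], ?_⟩⟩
  ext <;> simp [hs, hfr, hsr, h.1]

/-- A conflation whose inflation has a retraction is split. -/
theorem IsConflation.exists_section {X Y Z : A} {f : X ⟶ Y}
    {g : Y ⟶ Z} (h : E.IsConflation f g) (r : Y ⟶ X) (hr : f ≫ r = 𝟙 X) :
    ∃ s : Z ⟶ Y, s ≫ g = 𝟙 Z := by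
  obtain ⟨s, hs⟩ := h.exists_desc (𝟙 Y - r ≫ f) (by simp [reassoc_of% hr])
  have := h.epi
  exact ⟨s, by rw [← cancel_epi g]; simp [reassoc_of% hs, h.1]⟩

theorem IsConflation.nonempty_iso_of_retraction [HasBinaryBiproducts A] {X Y Z : A} {f : X ⟶ Y}
    {g : Y ⟶ Z} (h : E.IsConflation f g) (r : Y ⟶ X) (hr : f ≫ r = 𝟙 X) :
    Nonempty (Y ≅ X ⊞ Z) := by
  obtain ⟨s, hs⟩ := h.exists_section r hr
  obtain ⟨e⟩ := h.nonempty_iso_of_section s hs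
  exact ⟨e ≪≫ biprod.braiding _ _⟩

variable (E) in
theorem isConflation_id_zero (X : A) {Z : A} (hZ : IsZero Z) :
    E.IsConflation (𝟙 X) (0 : X ⟶ Z) := by
  have : Epi (0 : X ⟶ Z) := ⟨fun a b _ => hZ.eq_of_src a b⟩
  exact Inflation.isConflation (E := E) (E.id_inflation X) (by simp)
    fun t ht => ⟨0, by simpa using ht.symm⟩

section Biproducts

variable [HasBinaryBiproducts A]

theorem Deflation.biprod_map_id {X Y : A} {g : X ⟶ Y} (hg : E.Deflation g) (Z : A) :
    E.Deflation (biprod.map g (𝟙 Z)) := by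
  obtain ⟨K, k, hc⟩ := hg.exists_isConflation
  have sq : IsPullback (biprod.fst : X ⊞ Z ⟶ X) (biprod.map g (𝟙 Z)) g biprod.fst := by
    refine ⟨⟨by simp⟩, ⟨PullbackCone.IsLimit.mk _
      (fun s => biprod.lift s.fst (s.snd ≫ biprod.snd)) (by simp) ?_ ?_⟩⟩
    · intro s
      ext <;> simp [s.condition]
    · intro s m h₁ h₂
      ext
      · simp [h₁]
      · simp [← h₂]
  obtain ⟨f', hf', -⟩ := hc.of_isPullback sq
  exact hf'.deflation

variable [HasZeroObject A]

variable (E) in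
theorem isConflation_biprod (X Y : A) :
    E.IsConflation (biprod.inl : X ⟶ X ⊞ Y) (biprod.snd : X ⊞ Y ⟶ Y) := by
  obtain ⟨O, hO⟩ := HasZeroObject.zero (C := A)
  have sq : IsPullback (biprod.fst : X ⊞ Y ⟶ X) (biprod.snd : X ⊞ Y ⟶ Y)
      (0 : X ⟶ O) (0 : Y ⟶ O) := by
    refine ⟨⟨by simp⟩, ⟨PullbackCone.IsLimit.mk _
      (fun s => biprod.lift s.fst s.snd) (by simp) (by simp) ?_⟩⟩
    intro s m h₁ h₂
    ext <;> simp [h₁, h₂]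
  obtain ⟨f', hf', h⟩ := (E.isConflation_id_zero X hO).of_isPullback sq
  have : f' = biprod.inl := by
    ext <;> simp [h, hf'.1]
  rwa [← this]

variable (E) in
theorem deflation_biprod_snd (X Y : A) : E.Deflation (biprod.snd : X ⊞ Y ⟶ Y) :=
  (E.isConflation_biprod X Y).deflation

variable (E) in
theorem deflation_biprod_fst (X Y : A) : E.Deflation (biprod.fst : X ⊞ Y ⟶ X) := by
  have : (biprod.fst : X ⊞ Y ⟶ X) = (biprod.braiding X Y).hom ≫ biprod.snd := by simp
  rw [this]
  exact (E.deflation_of_iso _).comp (E.deflation_biprod_snd _ _)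

/-- A morphism with a kernel which becomes a deflation after precomposition with a morphism into its
source is a deflation. -/
theorem Deflation.of_comp_of_kernel {X Y Z K : A} {f : X ⟶ Y} {g : Y ⟶ Z}
    (h : E.Deflation (f ≫ g)) (k : K ⟶ Y) [Mono k] (w : k ≫ g = 0)
    (hl : ∀ {W : A} (t : W ⟶ Y), t ≫ g = 0 → ∃ l, l ≫ k = t) : E.Deflation g := by
  let σ : X ⊞ Y ≅ X ⊞ Y :=
    { hom := biprod.lift biprod.fst (biprod.snd - biprod.fst ≫ f)
      inv := biprod.lift biprod.fst (biprod.snd + biprod.fst ≫ f)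
      hom_inv_id := by ext <;> simp
      inv_hom_id := by ext <;> simp }
  let τ : Z ⊞ Y ≅ Z ⊞ Y :=
    { hom := biprod.lift (biprod.fst + biprod.snd ≫ g) biprod.snd
      inv := biprod.lift (biprod.fst - biprod.snd ≫ g) biprod.snd
      hom_inv_id := by ext <;> simp
      inv_hom_id := by ext <;> simp }
  -- The shears `σ` and `τ` turn `(x, y) ↦ g y` into `(f ≫ g) ⊞ 𝟙` followed by a projection. Its
  -- kernel is `𝟙 ⊞ k`, and pushing out along `X ⊞ K ⟶ K` removes the extra summand `X`.
  have h₁ : E.Deflation (biprod.snd ≫ g : X ⊞ Y ⟶ Z) := by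
    have : (biprod.snd ≫ g : X ⊞ Y ⟶ Z) =
        σ.hom ≫ biprod.map (f ≫ g) (𝟙 Y) ≫ τ.hom ≫ biprod.fst := by
      ext <;> simp [σ, τ]
    rw [this]
    exact (E.deflation_of_iso _).comp ((h.biprod_map_id Y).comp
      ((E.deflation_of_iso _).comp (E.deflation_biprod_fst _ _)))
  have : Mono (biprod.map (𝟙 X) k) := by
    constructor
    intro W a b hab
    have h₁ := hab =≫ biprod.fst
    have h₂ := hab =≫ biprod.snd
    ext
    · simpa using h₁
    · rw [← cancel_mono k]
      simpa using h₂
  have h₂ : E.IsConflation (biprod.map (𝟙 X) k) (biprod.snd ≫ g) := by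
    refine h₁.isConflation (by simp [w]) ?_
    intro W t ht
    obtain ⟨l, hl⟩ := hl (t ≫ biprod.snd) (by simpa using ht)
    exact ⟨biprod.lift (t ≫ biprod.fst) l, by ext <;> simp [hl]⟩
  have sq : IsPushout (biprod.map (𝟙 X) k) biprod.snd biprod.snd k := by
    refine ⟨⟨by simp⟩, ⟨PushoutCocone.IsColimit.mk _
      (fun s => biprod.inr ≫ s.inl) ?_ ?_ ?_⟩⟩
    · intro s
      have := biprod.inl ≫= s.condition
      ext
      · simpa using this.symm
      · simp
    · intro s
      have := biprod.inr ≫= s.condition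
      simpa using this
    · intro s m h₁ h₂
      simp [← h₁]
  obtain ⟨g', hg', e⟩ := h₂.of_isPushout sq
  have : g' = g := by
    have := biprod.inr ≫= e
    simpa using this
  exact this ▸ hg'.deflation

/-- In a weakly idempotent complete exact category, `g` is a deflation if `f ≫ g` is. -/
theorem Deflation.of_comp (hA : WeaklyIdempotentComplete A) {X Y Z : A} {f : X ⟶ Y} {g : Y ⟶ Z}
    (h : E.Deflation (f ≫ g)) : E.Deflation g := by
  obtain ⟨Q, b, g', sq, -⟩ := E.pullback_deflation (f ≫ g) g h
  let s : X ⟶ Q := sq.lift (𝟙 X) f (by simp)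
  have hs : s ≫ b = 𝟙 X := by simp [s]
  have := hA s b hs
  -- The complement of the section `s` is a kernel of `b`; since `b` is the pullback of `g`,
  -- composing with `g'` gives a kernel of `g`.
  let k : cokernel s ⟶ Q := cokernel.desc s (𝟙 Q - b ≫ s) (by simp [reassoc_of% hs])
  have hk : cokernel.π s ≫ k = 𝟙 Q - b ≫ s := by simp [k]
  have hkb : k ≫ b = 0 := by
    rw [← cancel_epi (cokernel.π s), reassoc_of% hk]
    simp [hs]
  have hkc : k ≫ cokernel.π s = 𝟙 _ := by
    rw [← cancel_epi (cokernel.π s), reassoc_of% hk]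
    simp
  have : Mono (k ≫ g') := by
    rw [Preadditive.mono_iff_cancel_zero]
    intro W t ht
    have : t ≫ k = 0 := sq.hom_ext (by simp [hkb]) (by simpa using ht)
    rw [← Category.comp_id t, ← hkc, reassoc_of% this, zero_comp]
  refine h.of_comp_of_kernel (k ≫ g') (by simp [← sq.w, reassoc_of% hkb]) ?_
  intro W t ht
  have ht' : sq.lift 0 t (by simp [ht]) ≫ 𝟙 Q = sq.lift 0 t (by simp [ht]) ≫
      cokernel.π s ≫ k := by
    rw [hk]; simp
  refine ⟨sq.lift 0 t (by simp [ht]) ≫ cokernel.π s, ?_⟩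
  have := ht' =≫ g'
  simpa using this.symm

end Biproducts

end Basic

end ExactStructure

namespace ExactStructure

/-! ### Vanishing of Ext through extension of morphisms. -/

section ExtOne

variable {A : Type u} [Category.{v} A] [Preadditive A]

/-- Vanishing of `Ext¹(X, Y)`: morphisms to `Y` extend along inflations with cokernel `X`. -/
def ExtOneVanishes (E : ExactStructure A) (X Y : A) : Prop :=
  ∀ ⦃K B : A⦄ (i : K ⟶ B) (p : B ⟶ X), E.IsConflation i p → ∀ h : K ⟶ Y, ∃ l : B ⟶ Y, i ≫ l = h

variable {E : ExactStructure A}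

namespace ExtOneVanishes

theorem exists_retraction {X Y : A} (hXY : E.ExtOneVanishes X Y) {B : A} {i : Y ⟶ B} {p : B ⟶ X}
    (h : E.IsConflation i p) : ∃ r : B ⟶ Y, i ≫ r = 𝟙 Y :=
  hXY i p h (𝟙 Y)

theorem exists_section {X Y : A} (hXY : E.ExtOneVanishes X Y) {B : A} {i : Y ⟶ B} {p : B ⟶ X}
    (h : E.IsConflation i p) : ∃ s : X ⟶ B, s ≫ p = 𝟙 X := by
  obtain ⟨r, hr⟩ := hXY.exists_retraction h
  exact h.exists_section r hr

/-- `Ext¹(X, Y) = 0` lets morphisms from `X` lift along deflations with kernel `Y`. -/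
theorem exists_lift {X Y : A} (hXY : E.ExtOneVanishes X Y) {B Z : A} {i : Y ⟶ B} {p : B ⟶ Z}
    (h : E.IsConflation i p) (t : X ⟶ Z) : ∃ l : X ⟶ B, l ≫ p = t := by
  obtain ⟨Q, b, f', g', sq, hc, -⟩ := h.exists_pullback t
  obtain ⟨s, hs⟩ := hXY.exists_section hc
  exact ⟨s ≫ b, by rw [Category.assoc, sq.w, reassoc_of% hs]⟩

/-- It suffices that all conflations `Y ↣ B ↠ X` split. -/
theorem of_exists_retraction {X Y : A} (H : ∀ {B : A} (i : Y ⟶ B) (p : B ⟶ X),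
    E.IsConflation i p → ∃ r : B ⟶ Y, i ≫ r = 𝟙 Y) : E.ExtOneVanishes X Y := by
  intro K B i p hc h
  obtain ⟨B', b, f', g', sq, hc', -⟩ := hc.exists_pushout h
  obtain ⟨r, hr⟩ := H f' g' hc'
  exact ⟨b ≫ r, by rw [reassoc_of% sq.w, hr, Category.comp_id]⟩

/-- It suffices to extend along one inflation into a projective object. -/
theorem of_isProjective {X Y K P : A} {k : K ⟶ P} {q : P ⟶ X} (hc : E.IsConflation k q)
    (hP : E.IsProjective P) (H : ∀ h : K ⟶ Y, ∃ l : P ⟶ Y, k ≫ l = h) :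
    E.ExtOneVanishes X Y := by
  intro D B i p hip h
  obtain ⟨φ, hφ⟩ := hP p hip.deflation q
  obtain ⟨Q, b, q', sq, -⟩ := E.pullback_deflation p q hip.deflation
  obtain ⟨k', hk', hk'q⟩ := hc.of_isPullback sq.flip
  -- The pulled-back conflation over `P` splits, with `u : Q ⟶ D` as retraction. The map `u ≫ h` is
  -- then corrected by a map from `P` until it vanishes on `K` and descends to `B`.
  obtain ⟨u, hu⟩ := hip.exists_lift (b - q' ≫ φ) (by simp [sq.w, hφ])
  have := hip.mono
  have hb := hk'.epi
  obtain ⟨m, hm⟩ := H (-k' ≫ u ≫ h)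
  obtain ⟨l, hl⟩ := hk'.exists_desc (u ≫ h + q' ≫ m) (by simp [reassoc_of% hk'q, hm])
  refine ⟨l, ?_⟩
  have h₁ : sq.lift i 0 (by simp [hip.1]) ≫ u = 𝟙 D := by
    rw [← cancel_mono i]; simp [hu]
  have h₂ := sq.lift i 0 (by simp [hip.1]) ≫= hl
  simpa [reassoc_of% h₁] using h₂

theorem of_iso {X X' Y : A} (h : E.ExtOneVanishes X Y) (e : X ≅ X') : E.ExtOneVanishes X' Y := by
  intro K B i p hip t
  exact h i (p ≫ e.inv) (hip.of_iso (Iso.refl _) (Iso.refl _) e.symm (by simp) (by simp)) t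

theorem of_retract_left {X X' Y : A} (h : E.ExtOneVanishes X Y) (s : X' ⟶ X) (r : X ⟶ X')
    (hr : s ≫ r = 𝟙 X') : E.ExtOneVanishes X' Y := by
  intro K B i p hip t
  obtain ⟨Q, b, f', g', sq, hc, hb⟩ := hip.exists_pullback r
  obtain ⟨l, hl⟩ := h f' g' hc t
  refine ⟨sq.lift (𝟙 B) (p ≫ s) (by simp [hr]) ≫ l, ?_⟩
  have : i ≫ sq.lift (𝟙 B) (p ≫ s) (by simp [hr]) = f' := by
    apply sq.hom_ext
    · simp [hb]
    · simp [hc.1, reassoc_of% hip.1]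
  rw [reassoc_of% this, hl]

theorem of_isProjective_left {P Y : A} (hP : E.IsProjective P) : E.ExtOneVanishes P Y := by
  apply of_exists_retraction
  intro B i p hip
  obtain ⟨s, hs⟩ := hP p hip.deflation (𝟙 P)
  have := hip.mono
  obtain ⟨r, hr⟩ := hip.exists_lift (𝟙 B - p ≫ s) (by simp [hs])
  exact ⟨r, by rw [← cancel_mono i]; simp [hr, reassoc_of% hip.1]⟩

/-- The extension is made in two stages: first to the preimage `L'` of `X` in `L`, whose quotient by
`K` is `X`, then from `L'` to `L`, with quotient `Z`. -/
theorem of_isConflation_left {X Y Z W : A} {f : X ⟶ Y} {g : Y ⟶ Z} (hc : E.IsConflation f g)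
    (hX : E.ExtOneVanishes X W) (hZ : E.ExtOneVanishes Z W) : E.ExtOneVanishes Y W := by
  intro K L i p hip h
  obtain ⟨L', b, i', p', sq, hc', hb⟩ := hip.exists_pullback f
  obtain ⟨m, hm⟩ := hX i' p' hc' h
  have := hc.mono
  have : Mono b := ⟨fun s t hst => sq.hom_ext hst (by
    rw [← cancel_mono f, Category.assoc, Category.assoc, ← sq.w, reassoc_of% hst])⟩
  have hb' : E.IsConflation b (p ≫ g) := by
    refine (hip.deflation.comp hc.deflation).isConflation (by simp [reassoc_of% sq.w, hc.1]) ?_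
    intro V t ht
    obtain ⟨a, ha⟩ := hc.exists_lift (t ≫ p) (by simpa using ht)
    exact ⟨sq.lift t a ha.symm, by simp⟩
  obtain ⟨l, hl⟩ := hZ b _ hb' m
  exact ⟨l, by rw [← hb, Category.assoc, hl, hm]⟩

end ExtOneVanishes

/-- Dimension shifting: `Ext²(Z, X)` vanishes if `Ext²(Z, Y₀)` and `Ext¹(Z, Y₁)` do. -/
theorem extOneVanishes_syzygy {K P Z X Y₀ Y₁ : A} {k : K ⟶ P} {q : P ⟶ Z}
    (hc : E.IsConflation k q) (hP : E.IsProjective P) {i : X ⟶ Y₀} {p : Y₀ ⟶ Y₁}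
    (hip : E.IsConflation i p) (h₀ : E.ExtOneVanishes K Y₀) (h₁ : E.ExtOneVanishes Z Y₁) :
    E.ExtOneVanishes K X := by
  intro D B a b hab h
  obtain ⟨m, hm⟩ := h₀ a b hab (h ≫ i)
  obtain ⟨n, hn⟩ := hab.exists_desc (m ≫ p) (by simp [reassoc_of% hm, hip.1])
  -- The obstruction `n : K ⟶ Y₁` to landing in `X` extends to `P` and then lifts to `Y₀`;
  -- subtracting this lift from `m` gives a map into `X`.
  obtain ⟨r, hr⟩ := h₁ k q hc n
  obtain ⟨s, hs⟩ := hP p hip.deflation r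
  obtain ⟨l, hl⟩ := hip.exists_lift (m - b ≫ k ≫ s) (by simp [hs, hr, hn])
  have := hip.mono
  exact ⟨l, by rw [← cancel_mono i]; simp [hl, hm, reassoc_of% hab.1]⟩

/-- `Ext¹(Z, X)` vanishes for a factor `X` of `T` with kernel `L` if `Ext²(Z, L)` and
`Ext¹(Z, T)` do. -/
theorem extOneVanishes_factor {K P Z L T X : A} {k : K ⟶ P} {q : P ⟶ Z}
    (hc : E.IsConflation k q) (hP : E.IsProjective P) {i : L ⟶ T} {p : T ⟶ X}
    (hip : E.IsConflation i p) (h₀ : E.ExtOneVanishes K L) (h₁ : E.ExtOneVanishes Z T) :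
    E.ExtOneVanishes Z X := by
  refine ExtOneVanishes.of_isProjective hc hP fun h => ?_
  obtain ⟨m, hm⟩ := h₀.exists_lift hip h
  obtain ⟨n, hn⟩ := h₁ k q hc m
  exact ⟨n ≫ p, by rw [reassoc_of% hn, hm]⟩

namespace ProjRes

variable {X : A} (R : E.ProjRes X) (Y : A)

/-- A cocycle in degree `n + 1` is the same as a map `syz (n + 1) ⟶ Y`, and it is a coboundary
exactly when that map extends along `ι n`. This is the dimension shift from degree `n + 1` to degree
one. -/
theorem subsingleton_cohomology_iff (n : ℕ) :
    Subsingleton (R.cohomology Y (n + 1)) ↔ E.ExtOneVanishes (R.syz n) Y := by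
  have hd : ∀ n, R.d n = R.π (n + 1) ≫ R.ι n := fun _ => rfl
  rw [QuotientAddGroup.subsingleton_iff, AddSubgroup.addSubgroupOf_eq_top]
  constructor
  · intro H
    refine ExtOneVanishes.of_isProjective (R.isConflation n) (R.isProjective n) fun h => ?_
    have hz : R.π (n + 1) ≫ h ∈ R.cocycles Y (n + 1) := by
      change R.d (n + 1) ≫ R.π (n + 1) ≫ h = 0
      rw [hd, Category.assoc, reassoc_of% (R.isConflation (n + 1)).1]
      simp
    obtain ⟨m, hm⟩ := H hz
    change R.d n ≫ m = R.π (n + 1) ≫ h at hm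
    have := (R.isConflation (n + 1)).epi
    exact ⟨m, by rw [← cancel_epi (R.π (n + 1)), ← Category.assoc, ← hd, hm]⟩
  · intro H z hz
    change R.d (n + 1) ≫ z = 0 at hz
    have := (R.isConflation (n + 1 + 1)).epi
    have hz' : R.ι (n + 1) ≫ z = 0 := by
      rw [← cancel_epi (R.π (n + 1 + 1)), ← Category.assoc, ← hd, hz, comp_zero]
    obtain ⟨h, hh⟩ := (R.isConflation (n + 1)).exists_desc z hz'
    obtain ⟨l, hl⟩ := H _ _ (R.isConflation n) h
    exact ⟨l, show R.d n ≫ l = z by rw [hd, Category.assoc, hl, hh]⟩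

end ProjRes

variable [E.EnoughProjectives]

theorem subsingleton_ext_one_iff (X Y : A) :
    Subsingleton (E.Ext 1 X Y) ↔ E.ExtOneVanishes X Y := by
  rw [(E.projRes X).subsingleton_cohomology_iff Y 0]
  exact ⟨fun h => h.of_iso (E.projRes X).isoZero, fun h => h.of_iso (E.projRes X).isoZero.symm⟩

theorem leftPerp_one_iff (𝒴 : ObjectProperty A) (X : A) :
    E.leftPerp 1 𝒴 X ↔ ∀ Y, 𝒴 Y → E.ExtOneVanishes X Y :=
  forall₂_congr fun _ _ => subsingleton_ext_one_iff _ _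

theorem totalRightPerp_iff (𝒳 : ObjectProperty A) (Y : A) :
    E.totalRightPerp 𝒳 Y ↔ ∀ X, 𝒳 X → ∀ n, E.ExtOneVanishes ((E.projRes X).syz n) Y := by
  constructor
  · intro h X hX n
    exact ((E.projRes X).subsingleton_cohomology_iff Y n).1 (h (n + 1) (by omega) X hX)
  · intro h n hn X hX
    obtain ⟨m, rfl⟩ : ∃ m, n = m + 1 := ⟨n - 1, by omega⟩
    exact ((E.projRes X).subsingleton_cohomology_iff Y m).2 (h X hX m)

variable (E) in
theorem exists_isProjective_isConflation (X : A) :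
    ∃ (K P : A) (k : K ⟶ P) (q : P ⟶ X), E.IsProjective P ∧ E.IsConflation k q := by
  obtain ⟨P, p, hP, hp⟩ := EnoughProjectives.exists_deflation (E := E) X
  obtain ⟨K, k, hc⟩ := hp.exists_isConflation
  exact ⟨K, P, k, p, hP, hc⟩

/-- One projective presentation of `W` suffices as a test: extend the image in `Z`, lift it to `Y`
by projectivity, and extend the remaining error, which lies in `X`. -/
theorem ExtOneVanishes.of_isConflation_right {W X Y Z : A} {f : X ⟶ Y} {g : Y ⟶ Z}
    (hc : E.IsConflation f g) (hX : E.ExtOneVanishes W X) (hZ : E.ExtOneVanishes W Z) :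
    E.ExtOneVanishes W Y := by
  obtain ⟨K, P, k, q, hP, hkq⟩ := E.exists_isProjective_isConflation W
  refine ExtOneVanishes.of_isProjective hkq hP fun h => ?_
  obtain ⟨m, hm⟩ := hZ k q hkq (h ≫ g)
  obtain ⟨n, hn⟩ := hP g hc.deflation m
  obtain ⟨a, ha⟩ := hc.exists_lift (h - k ≫ n) (by simp [hn, hm])
  obtain ⟨b, hb⟩ := hX k q hkq a
  exact ⟨b ≫ f + n, by simp [reassoc_of% hb, ha]⟩

end ExtOne

end ExactStructure

namespace ExactStructure

/-! ### Factors, torsion pairs and torsion classes. -/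

section Torsion

variable {A : Type u} [Category.{v} A] [Preadditive A] {E : ExactStructure A}

theorem le_fac (𝒯 : ObjectProperty A) {X : A} (hX : 𝒯 X) : E.Fac 𝒯 X :=
  ⟨X, 𝟙 X, hX, E.id_deflation X⟩

theorem Fac.of_deflation {𝒯 : ObjectProperty A} {X Y : A} (hX : E.Fac 𝒯 X) {p : X ⟶ Y}
    (hp : E.Deflation p) : E.Fac 𝒯 Y := by
  obtain ⟨T, q, hT, hq⟩ := hX
  exact ⟨T, q ≫ p, hT, hq.comp hp⟩

theorem fac_isClosedUnderIsomorphisms (𝒯 : ObjectProperty A) :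
    (E.Fac 𝒯).IsClosedUnderIsomorphisms :=
  ⟨fun e hX => hX.of_deflation (E.deflation_of_iso e)⟩

theorem fac_hom_eq_zero {𝒯 : ObjectProperty A} {X Y : A} (hX : E.Fac 𝒯 X)
    (hY : homRightPerp 𝒯 Y) (f : X ⟶ Y) : f = 0 := by
  obtain ⟨T, p, hT, hp⟩ := hX
  have := hp.epi
  rw [← cancel_epi p, hY T hT (p ≫ f), comp_zero]

/-- The pushout of an inflation along a deflation exists, and one of its legs is a deflation. -/
theorem exists_isPushout_of_inflation_of_deflation {X Y Z : A} {i : X ⟶ Y} {e : X ⟶ Z}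
    (hi : E.Inflation i) (he : E.Deflation e) :
    ∃ (W : A) (w : Y ⟶ W) (j : Z ⟶ W), IsPushout i e w j ∧ E.Deflation w := by
  obtain ⟨L, l, hl⟩ := he.exists_isConflation
  -- The pushout is the quotient of `Y` by the kernel `L` of `e`.
  obtain ⟨W, w, hw⟩ := (hl.inflation.comp hi).exists_isConflation
  obtain ⟨j, hj⟩ := hl.exists_desc (i ≫ w) (by simpa using hw.1)
  have := hw.epi
  have := hl.epi
  have H : ∀ s : PushoutCocone i e, ∃ t : W ⟶ s.pt, w ≫ t = s.inl := fun s =>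
    hw.exists_desc s.inl (by rw [Category.assoc, s.condition, reassoc_of% hl.1, zero_comp])
  choose t ht using H
  refine ⟨W, w, j, ⟨⟨hj.symm⟩, ⟨PushoutCocone.IsColimit.mk _ t ht ?_ ?_⟩⟩, hw.deflation⟩
  · intro s
    rw [← cancel_epi e, reassoc_of% hj, ht, s.condition]
  · intro s m h₁ h₂
    rw [← cancel_epi w, h₁, ht]

/-- If the map from `X` to its torsion-free part vanishes, the inclusion of the torsion part is an
isomorphism. Closure under factors and extensions follows from this description. -/
theorem IsTorsionPair.left_iff {𝒟 ℱ : ObjectProperty A} (h : E.IsTorsionPair 𝒟 ℱ) (X : A) :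
    𝒟 X ↔ ∀ F, ℱ F → ∀ f : X ⟶ F, f = 0 := by
  refine ⟨fun hX F hF f => h.hom_eq_zero hX hF f, fun H => ?_⟩
  obtain ⟨D, F, i, p, hc, hD, hF⟩ := h.exists_conflation X
  have := h.isoClosed_left
  obtain ⟨s, hs⟩ := hc.exists_lift (𝟙 X) (by rw [H F hF p, comp_zero])
  have := hc.mono
  exact 𝒟.prop_of_iso ⟨i, s, by rw [← cancel_mono i]; simp [hs], hs⟩ hD

theorem IsTorsionPair.right_iff {𝒟 ℱ : ObjectProperty A} (h : E.IsTorsionPair 𝒟 ℱ) (X : A) :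
    ℱ X ↔ homRightPerp 𝒟 X := by
  refine ⟨fun hX D hD f => h.hom_eq_zero hD hX f, fun H => ?_⟩
  obtain ⟨D, F, i, p, hc, hD, hF⟩ := h.exists_conflation X
  have := h.isoClosed_right
  obtain ⟨s, hs⟩ := hc.exists_desc (𝟙 X) (by rw [H D hD i, zero_comp])
  have := hc.epi
  exact ℱ.prop_of_iso ⟨s, p, by rw [← cancel_epi p]; simp [reassoc_of% hs], hs⟩ hF

theorem IsTorsionPair.isTorsionClass {𝒟 ℱ : ObjectProperty A} (h : E.IsTorsionPair 𝒟 ℱ) :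
    E.IsTorsionClass 𝒟 where
  isoClosed := h.isoClosed_left
  factorClosed X := by
    rintro ⟨T, p, hT, hp⟩
    rw [h.left_iff] at hT ⊢
    intro F hF f
    have := hp.epi
    rw [← cancel_epi p, hT F hF (p ≫ f), comp_zero]
  extensionClosed f g hc hX hZ := by
    rw [h.left_iff] at hX hZ ⊢
    intro F hF t
    obtain ⟨l, hl⟩ := hc.exists_desc t (hX F hF _)
    rw [← hl, hZ F hF l, comp_zero]

end Torsion

/-! ### Closure properties of torsion classes and left Ext-orthogonals. -/

section Biproducts

variable {A : Type u} [Category.{v} A] [Preadditive A] [HasZeroObject A] [HasBinaryBiproducts A]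
  {E : ExactStructure A}

omit [HasZeroObject A] in
theorem biprod_of_iso {𝒞 : ObjectProperty A} [𝒞.IsClosedUnderIsomorphisms]
    {X Y B : A} (e : B ≅ X ⊞ Y) (h : 𝒞 (X ⊞ Y)) : 𝒞 B :=
  𝒞.prop_of_iso e.symm h

theorem _root_.SummandClosed.isClosedUnderIsomorphisms {𝒞 : ObjectProperty A}
    (h : SummandClosed 𝒞) : 𝒞.IsClosedUnderIsomorphisms := by
  obtain ⟨O, hO⟩ := HasZeroObject.zero (C := A)
  exact ⟨fun {X Y} e hX => h (e ≪≫ isoBiprodZero hO) hX⟩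

namespace IsTorsionClass

variable {𝒟 : ObjectProperty A} (h : E.IsTorsionClass 𝒟)

include h

omit [HasZeroObject A] [HasBinaryBiproducts A] in
theorem of_deflation {X Y : A} (hX : 𝒟 X) {p : X ⟶ Y} (hp : E.Deflation p) : 𝒟 Y :=
  h.factorClosed Y ⟨X, p, hX, hp⟩

omit [HasZeroObject A] [HasBinaryBiproducts A] in
theorem zero {X Z : A} (hX : 𝒟 X) (hZ : IsZero Z) : 𝒟 Z :=
  h.of_deflation hX (E.isConflation_id_zero X hZ).deflation

theorem biprod {X Y : A} (hX : 𝒟 X) (hY : 𝒟 Y) : 𝒟 (X ⊞ Y) :=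
  h.extensionClosed _ _ (E.isConflation_biprod X Y) hX hY

theorem summandClosed : SummandClosed 𝒟 := fun e hY =>
  h.of_deflation hY ((E.deflation_of_iso e).comp (E.deflation_biprod_fst _ _))

end IsTorsionClass

omit [HasZeroObject A] in
/-- Factors of a rigid subcategory form a torsion class. -/
theorem isTorsionClass_fac {𝒯 : ObjectProperty A} (hb : ∀ {X Y : A}, 𝒯 X → 𝒯 Y → 𝒯 (X ⊞ Y))
    (hr : ∀ {T X : A}, 𝒯 T → E.Fac 𝒯 X → E.ExtOneVanishes T X) :
    E.IsTorsionClass (E.Fac 𝒯) where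
  isoClosed := fac_isClosedUnderIsomorphisms 𝒯
  factorClosed X := by
    rintro ⟨Y, p, hY, hp⟩
    exact hY.of_deflation hp
  extensionClosed f g hc hX hZ := by
    obtain ⟨T, q, hT, hq⟩ := hZ
    obtain ⟨K, k, hkq⟩ := hq.exists_isConflation
    -- Pulled back to `T`, the extension splits by rigidity, so its middle term is a factor of the
    -- sum of `T` and the left end.
    obtain ⟨Q, b, f', g', sq, hc', -⟩ := hc.exists_pullback q
    obtain ⟨r, hr⟩ := (hr hT hX).exists_retraction hc'
    obtain ⟨e⟩ := hc'.nonempty_iso_of_retraction r hr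
    obtain ⟨_, hb', _⟩ := hkq.of_isPullback sq.flip
    obtain ⟨T', q', hT', hq'⟩ := hX
    exact ⟨T' ⊞ T, biprod.map q' (𝟙 T) ≫ e.inv ≫ b, hb hT' hT,
      (hq'.biprod_map_id T).comp ((E.deflation_of_iso e.symm).comp hb'.deflation)⟩

omit [HasZeroObject A] [HasBinaryBiproducts A] in
theorem isProjective_of_isZero {P : A} (hP : IsZero P) : E.IsProjective P :=
  fun _ _ _ => ⟨0, hP.eq_of_src _ _⟩

variable [E.EnoughProjectives]

omit [HasZeroObject A] in
theorem leftPerp_summandClosed (𝒟 : ObjectProperty A) : SummandClosed (E.leftPerp 1 𝒟) := by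
  intro X X' Y e hY
  rw [leftPerp_one_iff] at hY ⊢
  exact fun D hD => (hY D hD).of_retract_left (biprod.inl ≫ e.inv) (e.hom ≫ biprod.fst) (by simp)

omit [HasZeroObject A] [HasBinaryBiproducts A] in
theorem leftPerp_isClosedUnderIsomorphisms (𝒟 : ObjectProperty A) :
    (E.leftPerp 1 𝒟).IsClosedUnderIsomorphisms := ⟨fun e hX => by
  rw [leftPerp_one_iff] at hX ⊢
  exact fun D hD => (hX D hD).of_iso e⟩

omit [HasZeroObject A] [HasBinaryBiproducts A] in
theorem leftPerp_extensionClosed (𝒟 : ObjectProperty A) {X Y Z : A} {f : X ⟶ Y} {g : Y ⟶ Z}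
    (hc : E.IsConflation f g) (hX : E.leftPerp 1 𝒟 X) (hZ : E.leftPerp 1 𝒟 Z) :
    E.leftPerp 1 𝒟 Y := by
  rw [leftPerp_one_iff] at *
  exact fun D hD => ExtOneVanishes.of_isConflation_left hc (hX D hD) (hZ D hD)

omit [HasZeroObject A] [HasBinaryBiproducts A] in
theorem leftPerp_of_isProjective {P : A} (hP : E.IsProjective P) (𝒟 : ObjectProperty A) :
    E.leftPerp 1 𝒟 P :=
  (leftPerp_one_iff _ _).2 fun _ _ => ExtOneVanishes.of_isProjective_left hP

/-- Nonemptiness is assumed because the empty class also satisfies the axioms of `IsTorsionClass`,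
yet lacks the zero object. -/
theorem additivelyClosed_leftPerp_inf {𝒟 : ObjectProperty A} (h : E.IsTorsionClass 𝒟)
    (hne : ∃ X, 𝒟 X) : AdditivelyClosed (E.leftPerp 1 𝒟 ⊓ 𝒟) where
  zero hZ := ⟨leftPerp_of_isProjective (isProjective_of_isZero hZ) 𝒟, h.zero hne.choose_spec hZ⟩
  biprod {X Y} hX hY := ⟨leftPerp_extensionClosed 𝒟 (E.isConflation_biprod X Y) hX.1 hY.1,
    h.biprod hX.2 hY.2⟩
  summand e hY := ⟨leftPerp_summandClosed 𝒟 e hY.1, h.summandClosed e hY.2⟩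

omit [HasZeroObject A] [HasBinaryBiproducts A] in
/-- A conflation `P ↣ D ↠ C` with `P` projective, `D` in `𝒟` and `C` in `{}^{⊥₁}𝒟` is a left
approximation sequence, and `D` lies in `{}^{⊥₁}𝒟`. -/
theorem IsConflation.isLeftApprox {𝒟 : ObjectProperty A} {P D C : A} {f : P ⟶ D} {g : D ⟶ C}
    (hc : E.IsConflation f g) (hP : E.IsProjective P) (hD : 𝒟 D) (hC : E.leftPerp 1 𝒟 C) :
    E.IsRightExact f g ∧ E.leftPerp 1 𝒟 D ∧ IsLeftApprox 𝒟 f :=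
  ⟨⟨P, 𝟙 P, f, E.id_deflation P, hc, Category.id_comp f⟩,
    leftPerp_extensionClosed 𝒟 hc (leftPerp_of_isProjective hP 𝒟) hC, hD,
    fun D' hD' h => (leftPerp_one_iff _ _).1 hC D' hD' f g hc h⟩

/-! ### From support τ-tilting subcategories to τ-cotorsion pairs and torsion pairs. -/

namespace IsSupportTauTilting

variable {𝒯 : ObjectProperty A} (h : E.IsSupportTauTilting 𝒯)

include h

omit [HasZeroObject A] in
theorem extOneVanishes {T X : A} (hT : 𝒯 T) (hX : E.Fac 𝒯 X) : E.ExtOneVanishes T X :=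
  (subsingleton_ext_one_iff _ _).1 (h.rigid hT hX)

omit [HasZeroObject A] in
theorem le_leftPerp {T : A} (hT : 𝒯 T) : E.leftPerp 1 (E.Fac 𝒯) T :=
  fun _ hX => h.rigid hT hX

omit [HasZeroObject A] in
theorem isTorsionClass : E.IsTorsionClass (E.Fac 𝒯) :=
  isTorsionClass_fac h.additivelyClosed.biprod h.extOneVanishes

omit [HasZeroObject A] in
theorem isTauCotorsionPair : E.IsTauCotorsionPair (E.leftPerp 1 (E.Fac 𝒯)) (E.Fac 𝒯) where
  isoClosed_left := leftPerp_isClosedUnderIsomorphisms _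
  isoClosed_right := fac_isClosedUnderIsomorphisms _
  eq_leftPerp := rfl
  exists_approx P hP := by
    obtain ⟨T₀, T₁, f, g, hfg, h₀, h₁, hf⟩ := h.exists_approx P hP
    refine ⟨T₀, T₁, f, g, hfg, h.le_leftPerp h₀, le_fac 𝒯 h₀, h.le_leftPerp h₁, le_fac 𝒯 h₀, ?_⟩
    rintro X ⟨T, p, hT, hp⟩ t
    -- As `P` is projective, a map to a factor of `T` lifts to `T`, so a left `𝒯`-approximation of
    -- `P` also approximates `Fac 𝒯`.
    obtain ⟨l, hl⟩ := hP p hp t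
    obtain ⟨m, hm⟩ := hf.2 T hT l
    exact ⟨m ≫ p, by rw [reassoc_of% hm, hl]⟩

/-- Every factor of a support `τ`-tilting subcategory has a cover with kernel a factor. -/
theorem exists_isConflation (hA : WeaklyIdempotentComplete A) {X : A} (hX : E.Fac 𝒯 X) :
    ∃ (K T : A) (i : K ⟶ T) (p : T ⟶ X), E.IsConflation i p ∧ E.Fac 𝒯 K ∧ 𝒯 T := by
  obtain ⟨T, p, hT, hp⟩ := hX
  obtain ⟨K, k, hkp⟩ := hp.exists_isConflation
  obtain ⟨P, q, hP, hq⟩ := EnoughProjectives.exists_deflation (E := E) K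
  obtain ⟨T₀, T₁, f, g, ⟨I, d, i, hd, hig, rfl⟩, h₀, h₁, hf⟩ := h.exists_approx P hP
  obtain ⟨φ, hφ⟩ := hf.2 T hT (q ≫ k)
  have := hd.epi
  have := hkp.mono
  -- The image `I` of the approximation maps to the kernel `K`; this map is a deflation because its
  -- composite with `d` is the cover `q`.
  obtain ⟨e, he⟩ := hkp.exists_lift (i ≫ φ) (by
    rw [← cancel_epi d, ← Category.assoc, ← Category.assoc, hφ, Category.assoc, hkp.1]
    simp)
  have hde : d ≫ e = q := by
    rw [← cancel_mono k, Category.assoc, he, ← Category.assoc, hφ]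
  have he' : E.Deflation e := Deflation.of_comp hA (f := d) (hde.symm ▸ hq)
  -- `W` replaces `K` as the kernel: it is a factor of `T₀`, and `K` embeds in it with cokernel
  -- `T₁`. The enlarged cover `B` is an extension of `T₁` by `T`, which splits by rigidity.
  obtain ⟨W, w, j, sq, hw⟩ := exists_isPushout_of_inflation_of_deflation hig.inflation he'
  obtain ⟨g', hjg, -⟩ := hig.of_isPushout sq
  obtain ⟨B, b, f', p', sq', hc, -⟩ := hkp.exists_pushout j
  obtain ⟨c, hbc, -⟩ := hjg.of_isPushout sq'.flip
  obtain ⟨r, hr⟩ := (h.extOneVanishes h₁ (le_fac 𝒯 hT)).exists_retraction hbc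
  obtain ⟨ε⟩ := hbc.nonempty_iso_of_retraction r hr
  have := SummandClosed.isClosedUnderIsomorphisms h.additivelyClosed.summand
  exact ⟨W, B, f', p', hc, ⟨T₀, w, h₀, hw⟩, biprod_of_iso ε (h.additivelyClosed.biprod hT h₁)⟩

theorem leftPerp_inf_fac (hA : WeaklyIdempotentComplete A) :
    E.leftPerp 1 (E.Fac 𝒯) ⊓ E.Fac 𝒯 = 𝒯 := by
  ext X
  refine ⟨fun ⟨hC, hX⟩ => ?_, fun hX => ⟨h.le_leftPerp hX, le_fac 𝒯 hX⟩⟩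
  obtain ⟨K, T, i, p, hc, hK, hT⟩ := h.exists_isConflation hA hX
  obtain ⟨s, hs⟩ := ((leftPerp_one_iff _ _).1 hC K hK).exists_section hc
  obtain ⟨e⟩ := hc.nonempty_iso_of_section s hs
  exact h.additivelyClosed.summand e hT

omit [HasZeroObject A] in
theorem isTorsionPair (hacf : E.IsACF 𝒯) : E.IsTorsionPair (E.Fac 𝒯) (homRightPerp 𝒯) where
  isoClosed_left := fac_isClosedUnderIsomorphisms _
  isoClosed_right := ⟨fun e hX T hT f => by
    rw [← cancel_mono e.inv, hX T hT (f ≫ e.inv), zero_comp]⟩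
  hom_eq_zero hC hD f := fac_hom_eq_zero hC hD f
  exists_conflation X := by
    obtain ⟨T, f, ⟨hT, hf⟩, I, d, i, hd, hi, rfl⟩ := hacf X
    obtain ⟨F, p, hc⟩ := hi.exists_isConflation
    refine ⟨I, F, i, p, hc, ⟨T, d, hT, hd⟩, fun T' hT' t => ?_⟩
    -- A map from `𝒯` to the cokernel lifts to `X` because the image `I` is in `Fac 𝒯`; the lift
    -- factors through the approximation, hence dies in `F`.
    obtain ⟨l, hl⟩ := (h.extOneVanishes hT' ⟨T, d, hT, hd⟩).exists_lift hc t
    obtain ⟨m, hm⟩ := hf T' hT' l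
    rw [← hl, ← hm, Category.assoc, Category.assoc, hc.1, comp_zero, comp_zero]

theorem isACF (hA : WeaklyIdempotentComplete A) {ℱ : ObjectProperty A}
    (hℱ : E.IsTorsionPair (E.Fac 𝒯) ℱ) : E.IsACF 𝒯 := by
  intro X
  obtain ⟨D, F, i, p, hc, hD, hF⟩ := hℱ.exists_conflation X
  obtain ⟨K, T, k, q, hkq, hK, hT⟩ := h.exists_isConflation hA hD
  refine ⟨T, q ≫ i, ⟨hT, fun T' hT' t => ?_⟩, D, q, i, hkq.deflation, hc.inflation, rfl⟩
  obtain ⟨l, hl⟩ := hc.exists_lift t (hℱ.hom_eq_zero (le_fac 𝒯 hT') hF _)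
  obtain ⟨m, hm⟩ := (h.extOneVanishes hT' hK).exists_lift hkq l
  exact ⟨m, by rw [reassoc_of% hm, hl]⟩

end IsSupportTauTilting

/-! ### From τ-cotorsion pairs to support τ-tilting subcategories. -/

namespace IsTauCotorsionPair

variable {𝒞 𝒟 : ObjectProperty A}

theorem fac_inf (hA : WeaklyIdempotentComplete A)
    (h : E.IsTauCotorsionPair 𝒞 𝒟) (hD : E.IsTorsionClass 𝒟) : E.Fac (𝒞 ⊓ 𝒟) = 𝒟 := by
  ext X
  constructor
  · rintro ⟨T, p, hT, hp⟩
    exact hD.of_deflation hT.2 hp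
  · intro hX
    obtain ⟨P, p, hP, hp⟩ := EnoughProjectives.exists_deflation (E := E) X
    obtain ⟨D, C, f, g, -, hDC, hDD, -, hf⟩ := h.exists_approx P hP
    obtain ⟨l, rfl⟩ := hf.2 X hX p
    exact ⟨D, l, ⟨hDC, hDD⟩, Deflation.of_comp hA hp⟩

theorem isSupportTauTilting (h : E.IsTauCotorsionPair 𝒞 𝒟) (hD : E.IsTorsionClass 𝒟) :
    E.IsSupportTauTilting (𝒞 ⊓ 𝒟) where
  additivelyClosed := by
    obtain ⟨O, hO⟩ := HasZeroObject.zero (C := A)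
    obtain ⟨D, C, f, g, -, -, hDD, -⟩ := h.exists_approx O (isProjective_of_isZero hO)
    rw [h.eq_leftPerp]
    exact additivelyClosed_leftPerp_inf hD ⟨D, hDD⟩
  rigid hT hX := by
    obtain ⟨T', p, hT', hp⟩ := hX
    have hC := hT.1
    rw [h.eq_leftPerp] at hC
    exact hC _ (hD.of_deflation hT'.2 hp)
  exists_approx P hP := by
    obtain ⟨D, C, f, g, hfg, hDC, hDD, hC, hf⟩ := h.exists_approx P hP
    obtain ⟨I, d, i, hd, hig, rfl⟩ := hfg
    -- `C` is a factor of `D`, so it lies in `𝒟` as well.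
    exact ⟨D, C, d ≫ i, g, ⟨I, d, i, hd, hig, rfl⟩, ⟨hDC, hDD⟩,
      ⟨hC, hD.of_deflation hDD hig.deflation⟩, ⟨hDC, hDD⟩, fun T hT t => hf.2 T hT.2 t⟩

end IsTauCotorsionPair

/-! ### From tilting subcategories to cotorsion pairs. -/

namespace IsTilting

variable {𝒯 : ObjectProperty A} (h : E.IsTilting 𝒯)

include h

omit [HasZeroObject A] [HasBinaryBiproducts A] in
theorem le_totalRightPerp {T : A} (hT : 𝒯 T) : E.totalRightPerp 𝒯 T := by
  rw [← h.enoughProjectives.1] at hT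
  exact hT.1

omit [HasZeroObject A] [HasBinaryBiproducts A] in
-- Objects of `𝒯` have projective dimension at most one: in a coresolution of `X` by two objects of
-- `𝒯^⊥`, the long exact sequence squeezes each `Ext^{n+2}(T, X)` between zeros.
theorem extOneVanishes_syz {T : A} (hT : 𝒯 T) (n : ℕ) (X : A) :
    E.ExtOneVanishes ((E.projRes T).syz (n + 1)) X := by
  obtain ⟨Y₀, Y₁, i, p, hc, h₀, h₁⟩ := h.coresolution X
  rw [totalRightPerp_iff] at h₀ h₁
  exact extOneVanishes_syzygy ((E.projRes T).isConflation n) ((E.projRes T).isProjective n) hc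
    (h₀ T hT (n + 1)) (h₁ T hT n)

omit [HasZeroObject A] [HasBinaryBiproducts A] in
theorem totalRightPerp_iff_extOneVanishes (X : A) :
    E.totalRightPerp 𝒯 X ↔ ∀ T, 𝒯 T → E.ExtOneVanishes T X := by
  rw [totalRightPerp_iff]
  constructor
  · exact fun H T hT => (H T hT 0).of_iso (E.projRes T).isoZero
  · rintro H T hT (_ | n)
    · exact (H T hT).of_iso (E.projRes T).isoZero.symm
    · exact h.extOneVanishes_syz hT n X

omit [HasZeroObject A] [HasBinaryBiproducts A] in
theorem fac_eq_totalRightPerp : E.Fac 𝒯 = E.totalRightPerp 𝒯 := by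
  ext X
  constructor
  · rintro ⟨T', p, hT', hp⟩
    obtain ⟨K, k, hkp⟩ := hp.exists_isConflation
    refine (h.totalRightPerp_iff_extOneVanishes X).2 fun T hT => ?_
    have := extOneVanishes_factor ((E.projRes T).isConflation 0) ((E.projRes T).isProjective 0)
      hkp (h.extOneVanishes_syz hT 0 K)
      ((totalRightPerp_iff _ _).1 (h.le_totalRightPerp hT') T hT 0)
    exact this.of_iso (E.projRes T).isoZero
  · intro hX
    obtain ⟨Y, T, i, p, hc, -, -, hT⟩ := h.enoughProjectives.2 X hX
    exact ⟨T, p, hT, hc.deflation⟩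

omit [HasZeroObject A] [HasBinaryBiproducts A] in
theorem extOneVanishes {T X : A} (hT : 𝒯 T) (hX : E.Fac 𝒯 X) : E.ExtOneVanishes T X := by
  rw [h.fac_eq_totalRightPerp, h.totalRightPerp_iff_extOneVanishes] at hX
  exact hX T hT

omit [HasZeroObject A] [HasBinaryBiproducts A] in
theorem le_leftPerp {T : A} (hT : 𝒯 T) : E.leftPerp 1 (E.Fac 𝒯) T :=
  (leftPerp_one_iff _ _).2 fun _ hX => h.extOneVanishes hT hX

omit [HasZeroObject A] [HasBinaryBiproducts A] in
theorem leftPerp_inf_fac : E.leftPerp 1 (E.Fac 𝒯) ⊓ E.Fac 𝒯 = 𝒯 := by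
  ext X
  refine ⟨fun ⟨hC, hX⟩ => ?_, fun hX => ⟨h.le_leftPerp hX, le_fac 𝒯 hX⟩⟩
  rw [leftPerp_one_iff] at hC
  rw [← h.enoughProjectives.1, ← h.fac_eq_totalRightPerp]
  -- Vanishing of Ext against `Fac 𝒯 = 𝒯^⊥` makes `X` projective in `𝒯^⊥`, hence an object of `𝒯`.
  exact ⟨hX, fun f g hc hY _ _ t => (hC _ hY).exists_lift hc t⟩

omit [HasZeroObject A] [HasBinaryBiproducts A] in
theorem isTorsionClass : E.IsTorsionClass (E.Fac 𝒯) where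
  isoClosed := fac_isClosedUnderIsomorphisms 𝒯
  factorClosed X := by
    rintro ⟨Y, p, hY, hp⟩
    exact hY.of_deflation hp
  extensionClosed f g hc hX hZ := by
    rw [h.fac_eq_totalRightPerp, h.totalRightPerp_iff_extOneVanishes] at *
    exact fun T hT => ExtOneVanishes.of_isConflation_right hc (hX T hT) (hZ T hT)

omit [HasZeroObject A] [HasBinaryBiproducts A] in
-- Pulling the given coresolution back along a cover of `Y₁` by `𝒯` puts the right end in `𝒯`; the
-- new middle term is an extension of `Y₀` by the kernel of the cover, both in `Fac 𝒯`.
theorem exists_coresolution (X : A) : ∃ (D T : A) (i : X ⟶ D) (p : D ⟶ T),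
    E.IsConflation i p ∧ 𝒯 T ∧ E.Fac 𝒯 D := by
  obtain ⟨Y₀, Y₁, i, p, hc, h₀, h₁⟩ := h.coresolution X
  obtain ⟨K, T, k, q, hkq, hK, -, hT⟩ := h.enoughProjectives.2 Y₁ h₁
  rw [← h.fac_eq_totalRightPerp] at h₀ hK
  obtain ⟨Q, b, f', g', sq, hc', -⟩ := hc.exists_pullback q
  obtain ⟨k', hk', -⟩ := hkq.of_isPullback sq.flip
  exact ⟨Q, T, f', g', hc', hT, h.isTorsionClass.extensionClosed _ _ hk' hK h₀⟩

theorem isSupportTauTilting : E.IsSupportTauTilting 𝒯 where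
  additivelyClosed := by
    obtain ⟨O, hO⟩ := HasZeroObject.zero (C := A)
    obtain ⟨D, T, i, p, -, -, hD⟩ := h.exists_coresolution O
    have := additivelyClosed_leftPerp_inf h.isTorsionClass ⟨D, hD⟩
    rwa [h.leftPerp_inf_fac] at this
  rigid hT hX := (subsingleton_ext_one_iff _ _).2 (h.extOneVanishes hT hX)
  exists_approx P hP := by
    obtain ⟨D, T, i, p, hc, hT, hD⟩ := h.exists_coresolution P
    obtain ⟨h₁, h₂, h₃⟩ := hc.isLeftApprox hP hD (h.le_leftPerp hT)
    have hD' : 𝒯 D := by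
      rw [← h.leftPerp_inf_fac]
      exact ⟨h₂, hD⟩
    exact ⟨D, T, i, p, h₁, hD', hT, hD', fun T' hT' => h₃.2 T' (le_fac 𝒯 hT')⟩

theorem isCotorsionPair : E.IsCotorsionPair (E.leftPerp 1 (E.Fac 𝒯)) (E.Fac 𝒯) where
  summandClosed_left := leftPerp_summandClosed _
  summandClosed_right := h.isTorsionClass.summandClosed
  ext_eq_zero hC hD := hC _ hD
  exists_left X := by
    obtain ⟨K, P, k, q, hP, hkq⟩ := E.exists_isProjective_isConflation X
    obtain ⟨D, T, i, p, hc, hT, hD⟩ := h.exists_coresolution K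
    -- Salce's trick: pushing the projective presentation out along `K ⟶ D` makes `B` both an
    -- extension of `X` by `D` and an extension of `T` by `P`.
    obtain ⟨B, b, f', g', sq, hc', -⟩ := hkq.exists_pushout i
    obtain ⟨c, hbc, -⟩ := hc.of_isPushout sq.flip
    exact ⟨D, B, f', g', hc',
      leftPerp_extensionClosed _ hbc (leftPerp_of_isProjective hP _) (h.le_leftPerp hT), hD⟩
  exists_right X := by
    obtain ⟨D, T, i, p, hc, hT, hD⟩ := h.exists_coresolution X
    exact ⟨D, T, i, p, hc, h.le_leftPerp hT, hD⟩

end IsTilting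

/-! ### From cotorsion pairs to tilting subcategories. -/

namespace IsCotorsionPair

variable {𝒞 𝒟 : ObjectProperty A} (h : E.IsCotorsionPair 𝒞 𝒟)

include h

omit [HasZeroObject A] in
theorem eq_leftPerp : 𝒞 = E.leftPerp 1 𝒟 := by
  ext X
  refine ⟨fun hX D hD => h.ext_eq_zero hX hD, fun hX => ?_⟩
  obtain ⟨D, C, i, p, hc, hC, hD⟩ := h.exists_left X
  obtain ⟨s, hs⟩ := ((leftPerp_one_iff _ _).1 hX D hD).exists_section hc
  obtain ⟨e⟩ := hc.nonempty_iso_of_section s hs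
  exact h.summandClosed_left e hC

theorem isTauCotorsionPair : E.IsTauCotorsionPair 𝒞 𝒟 where
  isoClosed_left := SummandClosed.isClosedUnderIsomorphisms h.summandClosed_left
  isoClosed_right := SummandClosed.isClosedUnderIsomorphisms h.summandClosed_right
  eq_leftPerp := h.eq_leftPerp
  exists_approx P hP := by
    obtain ⟨D, C, i, p, hc, hC, hD⟩ := h.exists_right P
    rw [h.eq_leftPerp] at hC
    obtain ⟨h₁, h₂, h₃⟩ := hc.isLeftApprox hP hD hC
    rw [← h.eq_leftPerp] at h₂ hC
    exact ⟨D, C, i, p, h₁, h₂, hD, hC, h₃⟩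

omit [HasZeroObject A] in
theorem extOneVanishes {C D : A} (hC : 𝒞 C) (hD : 𝒟 D) : E.ExtOneVanishes C D :=
  (subsingleton_ext_one_iff _ _).1 (h.ext_eq_zero hC hD)

omit [HasZeroObject A] in
/-- If `𝒟` is closed under factors, `Ext²(𝒞, -)` vanishes. -/
theorem extOneVanishes_syzygy (hD : E.IsTorsionClass 𝒟) {K P C X : A} {k : K ⟶ P} {q : P ⟶ C}
    (hc : E.IsConflation k q) (hP : E.IsProjective P) (hC : 𝒞 C) :
    E.ExtOneVanishes K X := by
  apply ExtOneVanishes.of_exists_retraction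
  intro B i p hip
  obtain ⟨D, C', j, r, hjr, -, hD'⟩ := h.exists_right B
  -- `Z` is the quotient of `D` by `X`, so it stays in `𝒟`. The induced map `K ⟶ Z` therefore
  -- extends to `P` and lifts to `D`; subtracting this from `j` retracts `B` onto `X`.
  obtain ⟨Z, z, hz⟩ := (hip.inflation.comp hjr.inflation).exists_isConflation
  have hZ : 𝒟 Z := hD.factorClosed Z ⟨D, z, hD', hz.deflation⟩
  obtain ⟨a, ha⟩ := hip.exists_desc (j ≫ z) (by simpa using hz.1)
  obtain ⟨b, hb⟩ := h.extOneVanishes hC hZ k q hc a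
  obtain ⟨l, hl⟩ := hP z hz.deflation b
  have := hjr.mono
  have := hip.mono
  obtain ⟨m, hm⟩ := hz.exists_lift (j - p ≫ k ≫ l) (by simp [hl, hb, ha])
  refine ⟨m, ?_⟩
  have : Mono (i ≫ j) := mono_comp i j
  rw [← cancel_mono (i ≫ j)]
  simp [hm, reassoc_of% hip.1]

theorem totalRightPerp_inf (hD : E.IsTorsionClass 𝒟) : E.totalRightPerp (𝒞 ⊓ 𝒟) = 𝒟 := by
  ext X
  rw [totalRightPerp_iff]
  constructor
  · intro hX
    obtain ⟨D, C, i, p, hc, hC, hDD⟩ := h.exists_right X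
    have hE : E.ExtOneVanishes C X :=
      (hX C ⟨hC, hD.factorClosed C ⟨D, p, hDD, hc.deflation⟩⟩ 0).of_iso (E.projRes C).isoZero
    obtain ⟨r, hr⟩ := hE.exists_retraction hc
    obtain ⟨e⟩ := hc.nonempty_iso_of_retraction r hr
    exact h.summandClosed_right e hDD
  · intro hX T hT n
    -- Since second Ext out of `𝒞` vanishes, `𝒞` is closed under syzygies, so first Ext controls all
    -- higher ones.
    have H : 𝒞 ((E.projRes T).syz n) := by
      have := SummandClosed.isClosedUnderIsomorphisms h.summandClosed_left
      induction n with
      | zero => exact 𝒞.prop_of_iso (E.projRes T).isoZero.symm hT.1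
      | succ n ih =>
        rw [h.eq_leftPerp, leftPerp_one_iff]
        exact fun Y _ => h.extOneVanishes_syzygy hD ((E.projRes T).isConflation n)
          ((E.projRes T).isProjective n) ih
    exact h.extOneVanishes H hX

theorem isTilting (hD : E.IsTorsionClass 𝒟) : E.IsTilting (𝒞 ⊓ 𝒟) := by
  have H : ∀ X, 𝒟 X → ∃ (Y T : A) (i : Y ⟶ T) (p : T ⟶ X),
      E.IsConflation i p ∧ 𝒟 Y ∧ 𝒟 T ∧ (𝒞 ⊓ 𝒟) T := by
    intro X hX
    obtain ⟨D, C, i, p, hc, hC, hDD⟩ := h.exists_left X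
    -- The cover of `X` by `𝒞` is an extension of two objects of `𝒟`, hence lies in `𝒞 ⊓ 𝒟`.
    have hC' := hD.extensionClosed _ _ hc hDD hX
    exact ⟨D, C, i, p, hc, hDD, hC', hC, hC'⟩
  refine ⟨?_, ?_⟩ <;> rw [h.totalRightPerp_inf hD]
  · refine ⟨?_, H⟩
    ext X
    constructor
    · rintro ⟨hX, hP⟩
      obtain ⟨Y, T, i, p, hc, hY, hT, hTC⟩ := H X hX
      obtain ⟨s, hs⟩ := hP i p hc hY hT hX (𝟙 X)
      obtain ⟨e⟩ := hc.nonempty_iso_of_section s hs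
      exact ⟨h.summandClosed_left e hTC.1, hX⟩
    · rintro ⟨hC, hX⟩
      exact ⟨hX, fun f g hc hY _ _ t => (h.extOneVanishes hC hY).exists_lift hc t⟩
  · intro X
    obtain ⟨D, C, i, p, hc, hC, hDD⟩ := h.exists_right X
    exact ⟨D, C, i, p, hc, hDD, hD.factorClosed C ⟨D, p, hDD, hc.deflation⟩⟩

end IsCotorsionPair

end Biproducts

end ExactStructure

/-! ### Assembling the bijections. -/

theorem mutuallyInverseOn_of_mapsTo {α β : Type*} {f : α → β} {g : β → α} {s : Set α} {t : Set β}
    (hf : ∀ a ∈ s, f a ∈ t) (hg : ∀ b ∈ t, g b ∈ s) (hgf : ∀ a ∈ s, g (f a) = a)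
    (hfg : ∀ b ∈ t, f (g b) = b) : MutuallyInverseOn f g s t :=
  have h : Set.InvOn g f s t := ⟨hgf, hfg⟩
  ⟨h.bijOn hf hg, h.symm.bijOn hg hf, h⟩

theorem corollary3p9 {A : Type u} [Category.{v} A] [Preadditive A]
    [HasZeroObject A] [HasBinaryBiproducts A] (E : ExactStructure A)
    [E.EnoughProjectives] (hA : WeaklyIdempotentComplete A) :
    -- the ambient bijections
    MutuallyInverseOn
      (fun 𝒯 : ObjectProperty A => (E.leftPerp 1 (E.Fac 𝒯), E.Fac 𝒯))
      (fun p : ObjectProperty A × ObjectProperty A => p.1 ⊓ p.2)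
      {𝒯 | E.IsSupportTauTilting 𝒯}
      {p | E.IsTauCotorsionPair p.1 p.2 ∧ E.IsTorsionClass p.2} ∧
    MutuallyInverseOn
      (fun 𝒯 : ObjectProperty A => (E.leftPerp 1 (E.Fac 𝒯), E.Fac 𝒯))
      (fun p : ObjectProperty A × ObjectProperty A => p.1 ⊓ p.2)
      {𝒯 | E.IsTilting 𝒯}
      {p | E.IsCotorsionPair p.1 p.2 ∧ E.IsTorsionClass p.2} ∧
    -- the smaller classes lie inside the ambient ones
    (∀ 𝒯 : ObjectProperty A, E.IsTilting 𝒯 → E.IsSupportTauTilting 𝒯) ∧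
    (∀ 𝒞 𝒟 ℱ : ObjectProperty A, E.IsTauCotorsionTorsionTriple 𝒞 𝒟 ℱ →
      E.IsTauCotorsionPair 𝒞 𝒟 ∧ E.IsTorsionClass 𝒟) ∧
    (∀ 𝒞 𝒟 ℱ : ObjectProperty A, E.IsCotorsionTorsionTriple 𝒞 𝒟 ℱ →
      E.IsTauCotorsionTorsionTriple 𝒞 𝒟 ℱ) ∧
    -- the restricted bijections
    MutuallyInverseOn
      (fun 𝒯 : ObjectProperty A => (E.leftPerp 1 (E.Fac 𝒯), E.Fac 𝒯, homRightPerp 𝒯))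
      (fun t : ObjectProperty A × ObjectProperty A × ObjectProperty A => t.1 ⊓ t.2.1)
      {𝒯 | E.IsSupportTauTilting 𝒯 ∧ E.IsACF 𝒯}
      {t | E.IsTauCotorsionTorsionTriple t.1 t.2.1 t.2.2} ∧
    MutuallyInverseOn
      (fun 𝒯 : ObjectProperty A => (E.leftPerp 1 (E.Fac 𝒯), E.Fac 𝒯, homRightPerp 𝒯))
      (fun t : ObjectProperty A × ObjectProperty A × ObjectProperty A => t.1 ⊓ t.2.1)
      {𝒯 | E.IsTilting 𝒯 ∧ E.IsACF 𝒯}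
      {t | E.IsCotorsionTorsionTriple t.1 t.2.1 t.2.2} := by
  have fg : ∀ 𝒞 𝒟 : ObjectProperty A, E.IsTauCotorsionPair 𝒞 𝒟 → E.IsTorsionClass 𝒟 →
      E.Fac (𝒞 ⊓ 𝒟) = 𝒟 ∧ E.leftPerp 1 (E.Fac (𝒞 ⊓ 𝒟)) = 𝒞 := fun 𝒞 𝒟 h hD =>
    ⟨h.fac_inf hA hD, by rw [h.fac_inf hA hD, ← h.eq_leftPerp]⟩
  -- The torsion-free class carries no extra data: deflations are epimorphisms, so `𝒞 ⊓ 𝒟` and its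
  -- factors, which form `𝒟`, have the same Hom-orthogonal.
  have perp : ∀ 𝒞 𝒟 ℱ : ObjectProperty A, E.IsTauCotorsionPair 𝒞 𝒟 → E.IsTorsionPair 𝒟 ℱ →
      homRightPerp (𝒞 ⊓ 𝒟) = ℱ := by
    intro 𝒞 𝒟 ℱ h hℱ
    ext X
    rw [hℱ.right_iff]
    refine ⟨fun hX D hD f => ?_, fun hX T hT f => hX T hT.2 f⟩
    rw [← h.fac_inf hA hℱ.isTorsionClass] at hD
    exact ExactStructure.fac_hom_eq_zero hD hX f
  have acf : ∀ 𝒞 𝒟 ℱ : ObjectProperty A, E.IsTauCotorsionPair 𝒞 𝒟 → E.IsTorsionPair 𝒟 ℱ →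
      E.IsACF (𝒞 ⊓ 𝒟) := by
    intro 𝒞 𝒟 ℱ h hℱ
    refine (h.isSupportTauTilting hℱ.isTorsionClass).isACF hA (ℱ := ℱ) ?_
    rwa [h.fac_inf hA hℱ.isTorsionClass]
  refine ⟨mutuallyInverseOn_of_mapsTo ?_ ?_ ?_ ?_, mutuallyInverseOn_of_mapsTo ?_ ?_ ?_ ?_,
    fun 𝒯 h => h.isSupportTauTilting, fun 𝒞 𝒟 ℱ h => ⟨h.1, h.2.isTorsionClass⟩,
    fun 𝒞 𝒟 ℱ h => ⟨h.1.isTauCotorsionPair, h.2⟩,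
    mutuallyInverseOn_of_mapsTo ?_ ?_ ?_ ?_, mutuallyInverseOn_of_mapsTo ?_ ?_ ?_ ?_⟩
  · exact fun 𝒯 h => ⟨h.isTauCotorsionPair, h.isTorsionClass⟩
  · exact fun p h => h.1.isSupportTauTilting h.2
  · exact fun 𝒯 h => h.leftPerp_inf_fac hA
  · exact fun p h => Prod.ext (fg _ _ h.1 h.2).2 (fg _ _ h.1 h.2).1
  · exact fun 𝒯 h => ⟨h.isCotorsionPair, h.isTorsionClass⟩
  · exact fun p h => h.1.isTilting h.2
  · exact fun 𝒯 h => h.leftPerp_inf_fac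
  · exact fun p h => Prod.ext (fg _ _ h.1.isTauCotorsionPair h.2).2
      (fg _ _ h.1.isTauCotorsionPair h.2).1
  · exact fun 𝒯 h => ⟨h.1.isTauCotorsionPair, h.1.isTorsionPair h.2⟩
  · exact fun t h => ⟨h.1.isSupportTauTilting h.2.isTorsionClass, acf _ _ _ h.1 h.2⟩
  · exact fun 𝒯 h => h.1.leftPerp_inf_fac hA
  · exact fun t h => Prod.ext (fg _ _ h.1 h.2.isTorsionClass).2
      (Prod.ext (fg _ _ h.1 h.2.isTorsionClass).1 (perp _ _ _ h.1 h.2))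
  · exact fun 𝒯 h => ⟨h.1.isCotorsionPair, h.1.isSupportTauTilting.isTorsionPair h.2⟩
  · exact fun t h => ⟨h.1.isTilting h.2.isTorsionClass,
      acf _ _ _ h.1.isTauCotorsionPair h.2⟩
  · exact fun 𝒯 h => h.1.leftPerp_inf_fac
  · exact fun t h => Prod.ext (fg _ _ h.1.isTauCotorsionPair h.2.isTorsionClass).2
      (Prod.ext (fg _ _ h.1.isTauCotorsionPair h.2.isTorsionClass).1
        (perp _ _ _ h.1.isTauCotorsionPair h.2))
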